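/- A quantum graph $\Gamma$ is a finite graph without loops (parallel edges allowed) with vertex set $V$ and edge set $E$, each edge $e$ being identified with a segment $[0,l_e]$, $l_e>0$, together with a boundary condition $A_v f|_v+B_v f'|_v=0$ at each vertex $v$. Here $f|_v$ and $f'|_v$ are the vectors of values and of outgoing derivatives of $f$ at $v$ along the edges $E_v$ incident to $v$, and $A_v,B_v$ are complex matrices with columns indexed by $E_v$ and finitely many rows. For $\lambda\in\mathbb C$, $\Phi_\Gamma(\lambda)$ is the space of functions $f=(f|_e)_{e\in E}$, $f|_e\in W^{2,2}([0,l_e])$, which satisfy all boundary conditions and $-f''=\lambda f$ on every edge. Let the finite group $G$ act on $V$ and $E$ so that incidence, edge lengths and boundary conditions are preserved, and suppose that no $g\in G$ carries a vertex to one of its neighbours (this can be achieved by adding vertices of valency two with Neumann conditions). Let $(W,\rho)$ be a $d$-dimensional complex representation of $G$. A quotient graph $\Gamma/\rho$ is constructed as follows. Choose representatives $\tilde e^i$ of $E/G$ and $\tilde v_k$ of $V/G$, a basis $B$ of $W$, and for each $i$ a basis $B^i=(b^i_j)_{j=1}^d$ of $W$ such that $b^i_1,\dots,b^i_{d_i}$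 is a basis of the trivial component of $\mathrm{Res}^G_{G_{\tilde e^i}}\rho$ and the other $b^i_j$ lie in the sum of the isotypic components of its nontrivial irreducible constituents. The vertices of $\Gamma/\rho$ are $v_k$, and its edges are $e^i_j$, $1\le j\le d_i$, of length $l_{\tilde e^i}$; $e^i_j$ joins $v_k$ and $v_{k'}$ if the endpoints of $\tilde e^i$ lie in $G\tilde v_k$ and $G\tilde v_{k'}$. If $E_{\tilde v_k}=\{g_l\tilde e^{\nu_l}\}_{l=1}^n$, the boundary condition at $v_k$ is given by $$A_{v_k}=(A_{\tilde v_k}\otimes I_d)\,D\,\Theta,\qquad B_{v_k}=(B_{\tilde v_k}\otimes I_d)\,D\,\Theta,\qquad D=\mathrm{diag}\big([\rho(g_1^{-1})]^{B}_{B^{\nu_1}},\dots,[\rho(g_n^{-1})]^{B}_{B^{\nu_n}}\big)^T,$$ where $[\cdot]^{B}_{B'}$ is the matrix of a linear map from the basis $B$ to the basis $B'$, and $\Theta$ has the entry $1$ in row $(l,j)$ and column $e^{\nu_l}_j$, and $0$ elsewhere; rows of $(A_{v_k}\,B_{v_k})$ may be eliminated as long as the remaining ones describe the same boundary condition. If $\Psi:W\to\Phi_\Gamma(\lambda)$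 is an intertwiner, where $(gf)(x)=f(g^{-1}x)$, its encoding on $\Gamma/\rho$ is the function with $f|_{e^i_j}=\Psi(b^i_j)|_{\tilde e^i}$. A transplantation from $\Gamma_1$ to $\Gamma_2$ is a linear map $T$ from functions on $\Gamma_1$ to functions on $\Gamma_2$, independent of $\lambda$, which expresses the restriction of $Tf$ to each edge as a linear combination of restrictions of $f$ to edges of the same length (each identified with the given edge by an isometry), and which for every $\lambda\in\mathbb C$ maps $\Phi_{\Gamma_1}(\lambda)$ bijectively onto $\Phi_{\Gamma_2}(\lambda)$. **Proposition.** Let $\Gamma$ and $G$ be as above, $H\le G$ a subgroup and $R$ a finite-dimensional complex representation of $H$. For any quotient graphs $\Gamma/R$ (constructed with respect to the group $H$) and $\Gamma/\mathrm{Ind}_H^G R$ (constructed with respect to $G$) obtained by this construction, with any choices, there is a transplantation from $\Gamma/R$ to $\Gamma/\mathrm{Ind}_H^G R$. It can be taken to be the composition of decoding and encoding: for every $\lambda\in\mathbb C$ and every intertwiner $\Psi:\mathrm{Ind}_H^G R\to\Phi_\Gamma(\lambda)$ it carries the encoding of $\Psi|_R$ on $\Gamma/R$ to the encoding of $\Psi$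 on $\Gamma/\mathrm{Ind}_H^G R$. -/

import Mathlib

open MeasureTheory Set
open scoped Kronecker

noncomputable section

/-- A metric graph without loops (parallel edges are allowed), on vertices `V` and edges `E`.
Each edge `e` joins `src e` to `tgt e` and is identified with the segment `[0, len e]` in such a
way that `0` is the end at `src e` and `len e` the end at `tgt e`. The choice of the direction of
the edge has no meaning beyond that of a coordinate. -/
structure MetricGraph (V E : Type*) where
  src : E → V
  tgt : E → V
  src_ne_tgt : ∀ e, src e ≠ tgt e
  len : E → ℝ
  len_pos : ∀ e, 0 < len e

namespace MetricGraph

variable {V E : Type*} (Γ : MetricGraph V E)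

/-- The set `E_v` of edges incident to the vertex `v`. -/
def Inc (v : V) : Type _ := {e : E // Γ.src e = v ∨ Γ.tgt e = v}

instance [Finite E] (v : V) : Fintype (Γ.Inc v) :=
  haveI : Finite (Γ.Inc v) := Subtype.finite
  Fintype.ofFinite _

/-- A function on the graph: a complex function on the segment `[0, len e]` for each edge `e`. -/
abbrev Fun : Type _ := (e : E) → Icc (0 : ℝ) (Γ.len e) → ℂ

/-- The restriction of `f` to the edge `e`, extended to `ℝ` by constants outside `[0, len e]`
(only the values on `[0, len e]` are ever used). -/
def edgeFun (f : Γ.Fun) (e : E) : ℝ → ℂ := IccExtend (Γ.len_pos e).le (f e)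

open Classical in
/-- The values of `f` at the vertex `v` along the edges incident to it. -/
def vertexValue (f : Γ.Fun) (v : V) (e : Γ.Inc v) : ℂ :=
  if Γ.src e.1 = v then Γ.edgeFun f e.1 0 else Γ.edgeFun f e.1 (Γ.len e.1)

open Classical in
/-- The outgoing derivatives of `f` at the vertex `v` along the edges incident to it. -/
def vertexDeriv (f : Γ.Fun) (v : V) (e : Γ.Inc v) : ℂ :=
  if Γ.src e.1 = v then derivWithin (Γ.edgeFun f e.1) (Icc 0 (Γ.len e.1)) 0
  else -derivWithin (Γ.edgeFun f e.1) (Icc 0 (Γ.len e.1)) (Γ.len e.1)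

end MetricGraph

/-- `u` belongs to the Sobolev space `W^{2,2}([0, l])` and `w` is its (weak) second derivative:
`u` is differentiable on `[0, l]`, and `u'` is absolutely continuous with derivative `w ∈ L²`.
(`u` is the continuously differentiable representative of its class.) -/
def HasSecondDeriv (l : ℝ) (u w : ℝ → ℂ) : Prop :=
  DifferentiableOn ℝ u (Icc 0 l) ∧
  MemLp w 2 (volume.restrict (Icc 0 l)) ∧
  ∀ x ∈ Icc 0 l,
    derivWithin u (Icc 0 l) x = derivWithin u (Icc 0 l) 0 + ∫ t in (0 : ℝ)..x, w t

/-- A quantum graph: a metric graph with, at each vertex `v`, a homogeneous boundary condition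
`A v · f|_v + B v · f'|_v = 0` involving the vector of values and the vector of outgoing
derivatives at `v`. The columns of `A v`, `B v` are indexed by the edges incident to `v`; any
finite number of rows is allowed, so that square matrices are the special case
`Row v = Fin (number of incident edges)`. -/
structure QuantumGraph (V E : Type*) extends MetricGraph V E where
  Row : V → Type
  finite_row : ∀ v, Finite (Row v)
  A : ∀ v, Matrix (Row v) (toMetricGraph.Inc v) ℂ
  B : ∀ v, Matrix (Row v) (toMetricGraph.Inc v) ℂ

namespace QuantumGraph

variable {V E : Type*} [Finite E] (Γ : QuantumGraph V E)

/-- The boundary condition at `v`, for a vector `x` of values and a vector `y` of outgoing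
derivatives. -/
def BoundaryCondition (v : V) (x y : Γ.Inc v → ℂ) : Prop :=
  (Γ.A v).mulVec x + (Γ.B v).mulVec y = 0

/-- The space `Φ_Γ(μ)` of eigenfunctions of the (negative) Laplacian with eigenvalue `μ`: functions
in `W^{2,2}(Γ)` which satisfy the boundary conditions at all vertices, with `-f'' = μ f` on each
edge. -/
def eigenspace (μ : ℂ) : Set Γ.Fun :=
  {f | (∀ e, ∃ w : ℝ → ℂ, HasSecondDeriv (Γ.len e) (Γ.edgeFun f e) w ∧
          ∀ᵐ x ∂(volume.restrict (Icc 0 (Γ.len e))), -w x = μ * Γ.edgeFun f e x) ∧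
       ∀ v, Γ.BoundaryCondition v (Γ.vertexValue f v) (Γ.vertexDeriv f v)}

/-- `G`, acting on vertices and edges, acts on the quantum graph `Γ`: the action preserves the
incidence relation, the lengths of the edges, and the boundary conditions at the vertices. -/
structure IsAction (G : Type*) [Group G] [MulAction G V] [MulAction G E] : Prop where
  ends : ∀ (g : G) (e : E), s(Γ.src (g • e), Γ.tgt (g • e)) = s(g • Γ.src e, g • Γ.tgt e)
  len : ∀ (g : G) (e : E), Γ.len (g • e) = Γ.len e
  boundary : ∀ (g : G) (v : V) (x y : E → ℂ),
    Γ.BoundaryCondition v (fun e => x e.1) (fun e => y e.1) →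
    Γ.BoundaryCondition (g • v) (fun e => x (g⁻¹ • e.1)) (fun e => y (g⁻¹ • e.1))

open Classical in
/-- The action of a group element on functions, `(g f)(p) = f(g⁻¹ p)`. The coordinate on the edge
`g⁻¹ e` is reversed if `g⁻¹` does not respect the chosen directions of `e` and `g⁻¹ e`. -/
def act {G : Type*} [Group G] [MulAction G V] [MulAction G E] (g : G) (f : Γ.Fun) : Γ.Fun :=
  fun e x => Γ.edgeFun f (g⁻¹ • e)
    (if Γ.src (g⁻¹ • e) = g⁻¹ • Γ.src e then (x : ℝ) else Γ.len e - x)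

end QuantumGraph

section Components

variable {G W : Type*} [Group G] [AddCommGroup W] [Module ℂ W] (ρ : Representation ℂ G W)
  (K : Subgroup G)

/-- The trivial component of the restriction of `ρ` to the subgroup `K`. -/
def trivialComponent : Submodule ℂ W := Representation.invariants (ρ.comp K.subtype)

/-- The sum of the isotypic components of the restriction of `ρ` to `K` which belong to the
nontrivial irreducible representations of `K`. -/
def nontrivialComponent : Submodule ℂ W :=
  ⨆ U : Subrepresentation (ρ.comp K.subtype),
    ⨆ _ : U.toRepresentation.IsIrreducible ∧ ¬ U.toRepresentation.IsTrivial, U.toSubmodule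

end Components

section Quotient

variable {V E G W : Type*} [Finite E] [Group G] [MulAction G V] [MulAction G E]
  [AddCommGroup W] [Module ℂ W]

/-- The class of an element in the set of orbits. -/
abbrev orbitOf (G : Type*) {X : Type*} [Group G] [MulAction G X] (x : X) :
    MulAction.orbitRel.Quotient G X := Quotient.mk _ x

/-- The choices made in the construction of a quotient graph `Γ/ρ`. -/
structure QuotientChoice (Γ : QuantumGraph V E) (ρ : Representation ℂ G W) where
  /-- representatives of the orbits of edges -/
  edgeRep : MulAction.orbitRel.Quotient G E → E
  edgeRep_spec : ∀ i, orbitOf G (edgeRep i) = i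
  /-- representatives of the orbits of vertices -/
  vertexRep : MulAction.orbitRel.Quotient G V → V
  vertexRep_spec : ∀ k, orbitOf G (vertexRep k) = k
  /-- a basis of the representation for each edge representative: its first `d_i` elements lie in
  the trivial component of the restriction to the stabilizer of the edge (whose dimension is
  `d_i`), the other ones in the sum of the nontrivial isotypic components -/
  edgeBasis : MulAction.orbitRel.Quotient G E → Module.Basis (Fin (Module.finrank ℂ W)) ℂ W
  edgeBasis_trivial : ∀ i (j : Fin (Module.finrank ℂ W)),
    (j : ℕ) < Module.finrank ℂ (trivialComponent ρ (MulAction.stabilizer G (edgeRep i))) →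
    edgeBasis i j ∈ trivialComponent ρ (MulAction.stabilizer G (edgeRep i))
  edgeBasis_nontrivial : ∀ i (j : Fin (Module.finrank ℂ W)),
    Module.finrank ℂ (trivialComponent ρ (MulAction.stabilizer G (edgeRep i))) ≤ (j : ℕ) →
    edgeBasis i j ∈ nontrivialComponent ρ (MulAction.stabilizer G (edgeRep i))
  /-- the global basis -/
  basis : Module.Basis (Fin (Module.finrank ℂ W)) ℂ W
  /-- the group elements `g_l` by which the edges at a vertex representative are written as
  `g_l • (edge representative)` -/
  move : ∀ k, Γ.Inc (vertexRep k) → G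
  move_spec : ∀ k e, move k e • edgeRep (orbitOf G e.1) = e.1

namespace QuotientChoice

variable {Γ : QuantumGraph V E} {ρ : Representation ℂ G W} (c : QuotientChoice Γ ρ)

/-- The edges `e^i_j`, `1 ≤ j ≤ d_i`, of the quotient graph. -/
def Edge : Type _ :=
  Σ i : MulAction.orbitRel.Quotient G E,
    {j : Fin (Module.finrank ℂ W) //
      (j : ℕ) < Module.finrank ℂ (trivialComponent ρ (MulAction.stabilizer G (c.edgeRep i)))}

instance : Finite c.Edge := by unfold Edge; infer_instance

/-- The quotient graph as a metric graph: its vertices are the orbits of vertices, and the edge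
`e^i_j` is a copy of the representative of the `i`-th orbit of edges. -/
def metricGraph (hG : ∀ (g : G) (e : E), g • Γ.src e ≠ Γ.tgt e) :
    MetricGraph (MulAction.orbitRel.Quotient G V) c.Edge where
  src p := orbitOf G (Γ.src (c.edgeRep p.1))
  tgt p := orbitOf G (Γ.tgt (c.edgeRep p.1))
  src_ne_tgt p h := by
    obtain ⟨g, hg⟩ := MulAction.orbitRel_apply.mp (Quotient.exact h)
    exact hG g⁻¹ (c.edgeRep p.1) (by rw [← hg]; simp)
  len p := Γ.len (c.edgeRep p.1)
  len_pos p := Γ.len_pos _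

variable (hG : ∀ (g : G) (e : E), g • Γ.src e ≠ Γ.tgt e)
  (k : MulAction.orbitRel.Quotient G V)

open Classical in
/-- The transpose of the block diagonal matrix with blocks `[ρ(g_l⁻¹)]`, each of them taken from
the global basis to the basis of the `l`-th edge. -/
def blockMatrix :
    Matrix (Γ.Inc (c.vertexRep k) × Fin (Module.finrank ℂ W))
      (Γ.Inc (c.vertexRep k) × Fin (Module.finrank ℂ W)) ℂ :=
  Matrix.of fun p q =>
    if p.1 = q.1 then
      LinearMap.toMatrix c.basis (c.edgeBasis (orbitOf G p.1.1)) (ρ (c.move k p.1)⁻¹) q.2 p.2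
    else 0

open Classical in
/-- The matrix `Θ`, which identifies the copies of an edge representative. -/
def thetaMatrix :
    Matrix (Γ.Inc (c.vertexRep k) × Fin (Module.finrank ℂ W)) ((c.metricGraph hG).Inc k) ℂ :=
  Matrix.of fun p q => if orbitOf G p.1.1 = q.1.1 ∧ p.2 = q.1.2.1 then 1 else 0

/-- `(A ⊗ I_d) · diag([ρ(g_l⁻¹)])ᵀ · Θ` -/
def matrixA : Matrix (Γ.Row (c.vertexRep k) × Fin (Module.finrank ℂ W))
    ((c.metricGraph hG).Inc k) ℂ :=
  Γ.A (c.vertexRep k) ⊗ₖ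
      (1 : Matrix (Fin (Module.finrank ℂ W)) (Fin (Module.finrank ℂ W)) ℂ) *
    c.blockMatrix k * c.thetaMatrix hG k

/-- `(B ⊗ I_d) · diag([ρ(g_l⁻¹)])ᵀ · Θ` -/
def matrixB : Matrix (Γ.Row (c.vertexRep k) × Fin (Module.finrank ℂ W))
    ((c.metricGraph hG).Inc k) ℂ :=
  Γ.B (c.vertexRep k) ⊗ₖ
      (1 : Matrix (Fin (Module.finrank ℂ W)) (Fin (Module.finrank ℂ W)) ℂ) *
    c.blockMatrix k * c.thetaMatrix hG k

/-- A choice of rows of the matrices `(A_v B_v)` at each vertex of the quotient, such that the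
remaining rows may be eliminated: the chosen ones still describe the same boundary conditions.
One may choose all rows, or so few that square matrices remain if this is possible. -/
structure RowChoice where
  keep : ∀ k, Set (Γ.Row (c.vertexRep k) × Fin (Module.finrank ℂ W))
  keep_spec : ∀ k (x y : (c.metricGraph hG).Inc k → ℂ),
    (∀ r ∈ keep k, ((c.matrixA hG k).mulVec x + (c.matrixB hG k).mulVec y) r = 0) →
    (c.matrixA hG k).mulVec x + (c.matrixB hG k).mulVec y = 0

variable {hG}

/-- The quotient quantum graph `Γ/ρ` obtained from the given choices. -/
def quotient (r : c.RowChoice hG) :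
    QuantumGraph (MulAction.orbitRel.Quotient G V) c.Edge where
  toMetricGraph := c.metricGraph hG
  Row k := {p // p ∈ r.keep k}
  finite_row k := by
    have := Γ.finite_row (c.vertexRep k)
    exact Subtype.finite
  A k := (c.matrixA hG k).submatrix Subtype.val id
  B k := (c.matrixB hG k).submatrix Subtype.val id

/-- The encoding of functions on `Γ` which transform according to `ρ` by a function on the
quotient graph: for a linear map `Ψ` from the carrier space of `ρ` to the functions on `Γ`, the
encoded function is, on the edge `e^i_j`, the restriction to the `i`-th edge representative of the
image of the `j`-th element of the `i`-th basis. -/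
def encode (r : c.RowChoice hG) (Ψ : W →ₗ[ℂ] Γ.Fun) : (c.quotient r).Fun :=
  fun p => Ψ (c.edgeBasis p.1 p.2.1) (c.edgeRep p.1)

end QuotientChoice

end Quotient

/-- Data for a linear map from functions on `Γ₁` to functions on `Γ₂` which expresses the
restriction of the image to each edge as a linear combination of restrictions of the given
function to edges of the same length. As the coordinate on an edge depends on the direction chosen
for it, it is also recorded for which pairs of edges the coordinate has to be reversed. -/
structure EdgeCombination {V₁ E₁ V₂ E₂ : Type*} (Γ₁ : MetricGraph V₁ E₁)
    (Γ₂ : MetricGraph V₂ E₂) where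
  coeff : E₂ → E₁ → ℂ
  reversed : E₂ → E₁ → Bool
  len_eq : ∀ e₂ e₁, coeff e₂ e₁ ≠ 0 → Γ₁.len e₁ = Γ₂.len e₂

namespace EdgeCombination

/-- The linear map on functions given by an `EdgeCombination`. -/
def toLinearMap {V₁ E₁ V₂ E₂ : Type*} [Finite E₁] {Γ₁ : MetricGraph V₁ E₁}
    {Γ₂ : MetricGraph V₂ E₂} (T : EdgeCombination Γ₁ Γ₂) : Γ₁.Fun →ₗ[ℂ] Γ₂.Fun :=
  letI := Fintype.ofFinite E₁
  { toFun := fun f e₂ x => ∑ e₁, T.coeff e₂ e₁ *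
      Γ₁.edgeFun f e₁ (if T.reversed e₂ e₁ then Γ₂.len e₂ - x else x)
    map_add' := fun f g => by
      funext e₂ x
      simp only [Pi.add_apply, MetricGraph.edgeFun, IccExtend, Function.comp_apply, mul_add,
        Finset.sum_add_distrib]
    map_smul' := fun a f => by
      funext e₂ x
      simp only [Pi.smul_apply, MetricGraph.edgeFun, IccExtend, Function.comp_apply, smul_eq_mul,
        RingHom.id_apply, Finset.mul_sum]
      exact Finset.sum_congr rfl fun _ _ => by ring }

/-- A transplantation: it bijects each eigenspace of the Laplacian of `Γ₁` onto the corresponding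
eigenspace of the Laplacian of `Γ₂`. -/
def IsTransplantation {V₁ E₁ V₂ E₂ : Type*} [Finite E₁] [Finite E₂] {Γ₁ : QuantumGraph V₁ E₁}
    {Γ₂ : QuantumGraph V₂ E₂} (T : EdgeCombination Γ₁.toMetricGraph Γ₂.toMetricGraph) : Prop :=
  ∀ μ : ℂ, BijOn T.toLinearMap (Γ₁.eigenspace μ) (Γ₂.eigenspace μ)

end EdgeCombination

end

/-!
Let `ρ` be a representation of `G` on `W`. Encoding identifies the intertwiners from `W` to the
functions on `Γ` with the functions on the quotient graph `Γ/ρ`, and intertwiners with values in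
`Φ_Γ(μ)` with `Φ_{Γ/ρ}(μ)`. Applied to `R` and to its induced representation, this turns Frobenius
reciprocity into the transplantation: decode a function on `Γ/R` to an intertwiner on `W`, extend
it to the induced representation, and encode the result.

Coordinates on edges. As no vertex is equivalent to one of its neighbours, all edges of an orbit can
be directed consistently (`exists_isInvariantOrientation`). In the coordinates which belong to these
directions (`MetricGraph.oriented`), the action of `G` only permutes edges, and no reversals occur.

Encoding is bijective (`QuotientChoice.encode_decode`, `QuotientChoice.decode_encode`). On an edge
representative `ẽ`, an intertwiner does not change under the stabilizer of `ẽ`, so it vanishes on the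
nontrivial isotypic components there and is determined by its values on the first `d_i` basis
vectors. Conversely, the coordinates with respect to these vectors are invariant under the
stabilizer (`coord_eq_of_mem_subgroup`), so a function on the quotient graph extends equivariantly
along the orbit of `ẽ`.

Eigenfunctions correspond to each other (`QuotientChoice.encode_mem_eigenspace_iff`). The matrices
`(A ⊗ 1) D Θ` and `(B ⊗ 1) D Θ`, applied to the values and derivatives of the encoding of `Ψ`, give
`A` and `B` applied to those of `Ψ b`, where `b` runs through the global basis
(`QuotientChoice.kronecker_mul_mulVec`). So the condition at a vertex of the quotient graph says that
all `Ψ w` satisfy the condition at the vertex representative, hence on its whole orbit.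

Finally, the values of the extended intertwiner on an edge are combinations of the restrictions of
the given function to edges of the same length (`exists_coeff`), so the composed map is of the form
required of a transplantation.
-/

/-! ### Trivial and nontrivial components -/

section Components

variable {G W : Type*} [Group G] [Finite G] [AddCommGroup W] [Module ℂ W]
  (ρ : Representation ℂ G W) (K : Subgroup G)

/-- A `K`-invariant linear map vanishes on the nontrivial isotypic components: on a nontrivial
irreducible `U` the sum `∑ k, ρ k` takes values in the invariants of `U`, which vanish. -/
theorem map_eq_zero_of_mem_nontrivialComponent {M : Type*} [AddCommGroup M] [Module ℂ M]
    (L : W →ₗ[ℂ] M) (hL : ∀ k ∈ K, ∀ w, L (ρ k w) = L w) {n : W}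
    (hn : n ∈ nontrivialComponent ρ K) : L n = 0 := by
  have : Fintype K := Fintype.ofFinite K
  have hle : nontrivialComponent ρ K ≤ LinearMap.ker L := by
    refine iSup_le fun U => iSup_le fun hU => ?_
    intro u hu
    -- the invariants of `U`, as a subrepresentation
    let I : Subrepresentation U.toRepresentation :=
      { toSubmodule := Representation.invariants U.toRepresentation
        apply_mem_toSubmodule := fun g v hv => by rw [hv g]; exact hv }
    have hI : I = ⊥ := by
      have := hU.1
      rcases eq_bot_or_eq_top I with h | h
      · exact h
      · refine absurd ⟨fun g => ?_⟩ hU.2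
        ext1 v
        have hv : v ∈ I.toSubmodule := by rw [h]; exact Submodule.mem_top
        exact hv g
    let a : U.toSubmodule := ∑ k : K, U.toRepresentation k ⟨u, hu⟩
    have ha : a ∈ I.toSubmodule := by
      intro g
      simp only [a, map_sum, ← Module.End.mul_apply, ← map_mul]
      exact Fintype.sum_equiv (Equiv.mulLeft g) _ _ fun _ => rfl
    have ha0 : a = 0 := by
      rw [hI] at ha
      exact (Submodule.mem_bot ℂ).mp ha
    have hLa : L (a : W) = (Fintype.card K : ℂ) • L u := by
      have : (a : W) = ∑ k : K, ρ k u := by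
        simp only [a, AddSubmonoidClass.coe_finsetSum]
        rfl
      rw [this, map_sum, Finset.sum_congr rfl fun (k : K) _ => hL k k.2 u]
      simp [Nat.cast_smul_eq_nsmul]
    rw [ha0] at hLa
    simpa [Fintype.card_ne_zero] using hLa.symm
  exact hle hn

/-- The coordinates belonging to the trivial component do not change under the action of `K`. -/
theorem coord_eq_of_mem_subgroup {m : ℕ} (b : Module.Basis (Fin m) ℂ W) (d : ℕ)
    (hb : ∀ j : Fin m, (j : ℕ) < d → b j ∈ trivialComponent ρ K)
    (hb' : ∀ j : Fin m, d ≤ (j : ℕ) → b j ∈ nontrivialComponent ρ K)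
    {j : Fin m} (hj : (j : ℕ) < d) {k : G} (hk : k ∈ K) (w : W) :
    b.coord j (ρ k w) = b.coord j w := by
  have : Fintype K := Fintype.ofFinite K
  -- up to the factor `card K`, `L` is the projection onto the trivial component along the other one
  let L : W →ₗ[ℂ] W := ∑ k : K, ρ k
  have hL : ∀ k ∈ K, ∀ w, L (ρ k w) = L w := by
    intro k hk w
    simp only [L, LinearMap.sum_apply, ← Module.End.mul_apply, ← map_mul]
    exact Fintype.sum_equiv (Equiv.mulRight (⟨k, hk⟩ : K)) _ _ fun _ => rfl
  have hLb : b.coord j ∘ₗ L = (Fintype.card K : ℂ) • b.coord j := by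
    refine b.ext fun i => ?_
    rcases lt_or_ge (i : ℕ) d with hi | hi
    · have : L (b i) = (Fintype.card K : ℂ) • b i := by
        have h : ∀ k : K, ρ k (b i) = b i := hb i hi
        simp [L, LinearMap.sum_apply, h, Nat.cast_smul_eq_nsmul]
      simp [this]
    · have hij : i ≠ j := by rintro rfl; omega
      have : L (b i) = 0 := map_eq_zero_of_mem_nontrivialComponent ρ K L hL (hb' i hi)
      simp [this, hij]
  have h1 := LinearMap.congr_fun hLb (ρ k w)
  have h2 := LinearMap.congr_fun hLb w
  simp only [LinearMap.comp_apply, hL k hk, LinearMap.smul_apply] at h1 h2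
  exact smul_right_injective ℂ (Nat.cast_ne_zero.mpr Fintype.card_ne_zero) (h1.symm.trans h2)

end Components

/-! ### The eigenvalue equation on a segment -/

/-- `u` is a solution in `W^{2,2}([0, l])` of the eigenvalue equation `-u'' = μ u`. -/
def IsEigenfunctionOn (l : ℝ) (μ : ℂ) (u : ℝ → ℂ) : Prop :=
  ∃ w : ℝ → ℂ, HasSecondDeriv l u w ∧ ∀ᵐ x ∂(volume.restrict (Icc 0 l)), -w x = μ * u x

/-- The eigenvalue equation in integrated form, with the weak second derivative eliminated. -/
theorem isEigenfunctionOn_iff {l : ℝ} {μ : ℂ} {u : ℝ → ℂ} :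
    IsEigenfunctionOn l μ u ↔ DifferentiableOn ℝ u (Icc 0 l) ∧ ∀ x ∈ Icc 0 l,
      derivWithin u (Icc 0 l) x = derivWithin u (Icc 0 l) 0 - μ * ∫ t in (0 : ℝ)..x, u t := by
  have key : ∀ w : ℝ → ℂ, (∀ᵐ x ∂(volume.restrict (Icc 0 l)), -w x = μ * u x) →
      ∀ x ∈ Icc 0 l, ∫ t in (0 : ℝ)..x, w t = -(μ * ∫ t in (0 : ℝ)..x, u t) := by
    intro w hw x hx
    rw [← intervalIntegral.integral_const_mul, ← intervalIntegral.integral_neg]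
    refine intervalIntegral.integral_congr_ae ?_
    rw [ae_restrict_iff' measurableSet_Icc] at hw
    filter_upwards [hw] with t ht ht'
    rw [uIoc_of_le hx.1] at ht'
    rw [← ht ⟨ht'.1.le, ht'.2.trans hx.2⟩, neg_neg]
  constructor
  · rintro ⟨w, ⟨hd, -, hi⟩, hw⟩
    refine ⟨hd, fun x hx => ?_⟩
    rw [hi x hx, key w hw x hx, sub_eq_add_neg]
  · rintro ⟨hd, hi⟩
    have hw : ∀ᵐ x ∂(volume.restrict (Icc 0 l)), -(-(μ * u x)) = μ * u x := by simp
    refine ⟨fun x => -(μ * u x), ⟨hd, ?_, fun x hx => ?_⟩, hw⟩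
    · have hc : ContinuousOn (fun x => -(μ * u x)) (Icc 0 l) :=
        (continuousOn_const.mul hd.continuousOn).neg
      obtain ⟨C, hC⟩ := isCompact_Icc.exists_bound_of_continuousOn hc
      exact MemLp.of_bound (hc.aestronglyMeasurable measurableSet_Icc) C
        (ae_restrict_of_forall_mem measurableSet_Icc hC)
    · rw [hi x hx, key _ hw x hx, sub_eq_add_neg]

namespace IsEigenfunctionOn

variable {l : ℝ} {μ : ℂ} {u v : ℝ → ℂ}

theorem differentiableOn (hu : IsEigenfunctionOn l μ u) : DifferentiableOn ℝ u (Icc 0 l) :=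
  (isEigenfunctionOn_iff.mp hu).1

theorem intervalIntegrable (hu : IsEigenfunctionOn l μ u) {a b : ℝ} (ha : a ∈ Icc 0 l)
    (hb : b ∈ Icc 0 l) : IntervalIntegrable u volume a b :=
  (hu.differentiableOn.continuousOn.mono (uIcc_subset_Icc ha hb)).intervalIntegrable

theorem zero : IsEigenfunctionOn l μ 0 :=
  isEigenfunctionOn_iff.mpr ⟨differentiableOn_const 0, fun x _ => by simp⟩

theorem add (hl : 0 < l) (hu : IsEigenfunctionOn l μ u) (hv : IsEigenfunctionOn l μ v) :
    IsEigenfunctionOn l μ (u + v) := by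
  have h0 : (0 : ℝ) ∈ Icc 0 l := left_mem_Icc.mpr hl.le
  refine isEigenfunctionOn_iff.mpr ⟨hu.differentiableOn.add hv.differentiableOn, fun x hx => ?_⟩
  rw [derivWithin_add (hu.differentiableOn x hx) (hv.differentiableOn x hx),
    derivWithin_add (hu.differentiableOn 0 h0) (hv.differentiableOn 0 h0),
    (isEigenfunctionOn_iff.mp hu).2 x hx, (isEigenfunctionOn_iff.mp hv).2 x hx]
  simp only [Pi.add_apply]
  rw [intervalIntegral.integral_add (hu.intervalIntegrable h0 hx) (hv.intervalIntegrable h0 hx)]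
  ring

theorem smul (hl : 0 < l) (a : ℂ) (hu : IsEigenfunctionOn l μ u) :
    IsEigenfunctionOn l μ (a • u) := by
  have h0 : (0 : ℝ) ∈ Icc 0 l := left_mem_Icc.mpr hl.le
  refine isEigenfunctionOn_iff.mpr ⟨hu.differentiableOn.const_smul a, fun x hx => ?_⟩
  rw [derivWithin_const_smul a (hu.differentiableOn x hx),
    derivWithin_const_smul a (hu.differentiableOn 0 h0), (isEigenfunctionOn_iff.mp hu).2 x hx]
  simp only [Pi.smul_apply, smul_eq_mul, intervalIntegral.integral_const_mul]
  ring

theorem sum (hl : 0 < l) {ι : Type*} (t : Finset ι) (a : ι → ℂ) {w : ι → ℝ → ℂ}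
    (hw : ∀ i ∈ t, IsEigenfunctionOn l μ (w i)) : IsEigenfunctionOn l μ (∑ i ∈ t, a i • w i) :=
  Finset.sum_induction _ (IsEigenfunctionOn l μ) (fun _ _ => add hl) zero
    fun i hi => smul hl _ (hw i hi)

end IsEigenfunctionOn

theorem derivWithin_Icc_comp_const_sub (l : ℝ) (u : ℝ → ℂ) (x : ℝ) :
    derivWithin (fun y => u (l - y)) (Icc 0 l) x = -derivWithin u (Icc 0 l) (l - x) := by
  rw [derivWithin_comp_const_sub]
  congr 2
  ext y
  simp

theorem IsEigenfunctionOn.comp_const_sub {l : ℝ} {μ : ℂ} {u : ℝ → ℂ} (hl : 0 < l)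
    (hu : IsEigenfunctionOn l μ u) : IsEigenfunctionOn l μ fun x => u (l - x) := by
  have h0 : (0 : ℝ) ∈ Icc 0 l := left_mem_Icc.mpr hl.le
  have h1 : l ∈ Icc 0 l := right_mem_Icc.mpr hl.le
  have hm : ∀ x ∈ Icc 0 l, l - x ∈ Icc 0 l := fun x hx => ⟨by linarith [hx.2], by linarith [hx.1]⟩
  obtain ⟨hd, hi⟩ := isEigenfunctionOn_iff.mp hu
  refine isEigenfunctionOn_iff.mpr
    ⟨hd.comp (differentiableOn_id.const_sub l) hm, fun x hx => ?_⟩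
  rw [derivWithin_Icc_comp_const_sub, derivWithin_Icc_comp_const_sub, hi _ (hm x hx),
    hi _ (hm 0 h0), intervalIntegral.integral_comp_sub_left (fun t => u t), sub_zero,
    ← intervalIntegral.integral_add_adjacent_intervals (hu.intervalIntegrable h0 (hm x hx))
      (hu.intervalIntegrable (hm x hx) h1)]
  ring

/-! ### Oriented coordinates on the edges -/

noncomputable section

/-- The functions on `ℝ` which are constant to the left and to the right of `[0, l]`. They
correspond to the functions on `[0, l]`. -/
def constExtended (l : ℝ) : Submodule ℂ (ℝ → ℂ) where
  carrier := {u | ∀ x, u x = u (max 0 (min l x))}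
  add_mem' hu hv x := by rw [Pi.add_apply, Pi.add_apply, hu x, hv x]
  zero_mem' _ := rfl
  smul_mem' a u hu x := by rw [Pi.smul_apply, Pi.smul_apply, hu x]

theorem eq_of_eqOn_of_mem_constExtended {l : ℝ} (hl : 0 < l) {u v : ℝ → ℂ}
    (hu : u ∈ constExtended l) (hv : v ∈ constExtended l) (h : EqOn u v (Icc 0 l)) : u = v := by
  funext x
  rw [hu x, hv x]
  exact h ⟨le_max_left _ _, max_le hl.le (min_le_left _ _)⟩

theorem comp_const_sub_mem_constExtended {l : ℝ} (hl : 0 < l) {u : ℝ → ℂ}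
    (hu : u ∈ constExtended l) : (fun x => u (l - x)) ∈ constExtended l := by
  intro x
  simp only
  rw [hu (l - x), hu (l - max 0 (min l x))]
  congr 1
  simp only [max_def, min_def]
  split_ifs <;> linarith

/-- The value of `u` at an end of `[0, l]`: at `0` if `b`, at `l` otherwise. -/
def endValue (l : ℝ) (b : Bool) (u : ℝ → ℂ) : ℂ := if b then u 0 else u l

/-- The derivative of `u` at an end of `[0, l]`, directed to the interior of the segment: at `0` if
`b`, at `l` otherwise. -/
def endDeriv (l : ℝ) (b : Bool) (u : ℝ → ℂ) : ℂ :=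
  if b then derivWithin u (Icc 0 l) 0 else -derivWithin u (Icc 0 l) l

theorem endValue_add (l : ℝ) (b : Bool) (u v : ℝ → ℂ) :
    endValue l b (u + v) = endValue l b u + endValue l b v := by
  unfold endValue
  split_ifs <;> rfl

theorem endValue_smul (l : ℝ) (b : Bool) (a : ℂ) (u : ℝ → ℂ) :
    endValue l b (a • u) = a • endValue l b u := by
  unfold endValue
  split_ifs <;> rfl

section EndTraces

variable {l : ℝ} (hl : 0 < l) (b : Bool) {u v : ℝ → ℂ}
include hl

theorem endDeriv_add (hu : DifferentiableOn ℝ u (Icc 0 l)) (hv : DifferentiableOn ℝ v (Icc 0 l)) :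
    endDeriv l b (u + v) = endDeriv l b u + endDeriv l b v := by
  have h0 : (0 : ℝ) ∈ Icc 0 l := left_mem_Icc.mpr hl.le
  have h1 : l ∈ Icc 0 l := right_mem_Icc.mpr hl.le
  unfold endDeriv
  split_ifs
  · exact derivWithin_add (hu 0 h0) (hv 0 h0)
  · rw [derivWithin_add (hu l h1) (hv l h1), neg_add]

theorem endDeriv_smul (a : ℂ) (hu : DifferentiableOn ℝ u (Icc 0 l)) :
    endDeriv l b (a • u) = a • endDeriv l b u := by
  have h0 : (0 : ℝ) ∈ Icc 0 l := left_mem_Icc.mpr hl.le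
  have h1 : l ∈ Icc 0 l := right_mem_Icc.mpr hl.le
  unfold endDeriv
  split_ifs
  · exact derivWithin_const_smul a (hu 0 h0)
  · rw [derivWithin_const_smul a (hu l h1), smul_neg]

end EndTraces

namespace MetricGraph

variable {V E : Type*} (Γ : MetricGraph V E) (s : E → Bool)

/-- The start of the edge `e` after the reversal of all edges with `s e = false`. -/
def start (e : E) : V := if s e then Γ.src e else Γ.tgt e

/-- The restriction of a function to the edge `e`, in the coordinate which belongs to the direction
of the edge after the reversal of all edges with `s e = false`. -/
def oriented (e : E) : Γ.Fun →ₗ[ℂ] (ℝ → ℂ) where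
  toFun f x := Γ.edgeFun f e (if s e then x else Γ.len e - x)
  map_add' _ _ := rfl
  map_smul' _ _ := rfl

/-- The function with given restrictions to the edges, in the coordinates of `oriented`. -/
def ofOriented (u : E → ℝ → ℂ) : Γ.Fun := fun e x => u e (if s e then x else Γ.len e - x)

variable {Γ s}

theorem edgeFun_of_mem (f : Γ.Fun) (e : E) {x : ℝ} (hx : x ∈ Icc 0 (Γ.len e)) :
    Γ.edgeFun f e x = f e ⟨x, hx⟩ :=
  IccExtend_of_mem _ _ hx

theorem edgeFun_mem_constExtended (f : Γ.Fun) (e : E) :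
    Γ.edgeFun f e ∈ constExtended (Γ.len e) := by
  intro x
  have hx : max 0 (min (Γ.len e) x) ∈ Icc 0 (Γ.len e) :=
    ⟨le_max_left _ _, max_le (Γ.len_pos e).le (min_le_left _ _)⟩
  rw [edgeFun_of_mem f e hx]
  rfl

theorem oriented_apply (f : Γ.Fun) (e : E) (x : ℝ) :
    Γ.oriented s e f x = Γ.edgeFun f e (if s e then x else Γ.len e - x) := rfl

theorem oriented_eq (f : Γ.Fun) (e : E) : Γ.oriented s e f =
    if s e then Γ.edgeFun f e else fun x => Γ.edgeFun f e (Γ.len e - x) := by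
  funext x
  rw [oriented_apply]
  split_ifs <;> rfl

theorem oriented_mem_constExtended (f : Γ.Fun) (e : E) :
    Γ.oriented s e f ∈ constExtended (Γ.len e) := by
  rw [oriented_eq]
  split_ifs
  · exact edgeFun_mem_constExtended f e
  · exact comp_const_sub_mem_constExtended (Γ.len_pos e) (edgeFun_mem_constExtended f e)

theorem sub_mem_Icc_len {e : E} {x : ℝ} (hx : x ∈ Icc 0 (Γ.len e)) :
    (if s e then x else Γ.len e - x) ∈ Icc 0 (Γ.len e) := by
  split_ifs
  · exact hx
  · exact ⟨by linarith [hx.2], by linarith [hx.1]⟩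

theorem oriented_ofOriented (u : E → ℝ → ℂ) {e : E} (hu : u e ∈ constExtended (Γ.len e)) :
    Γ.oriented s e (Γ.ofOriented s u) = u e := by
  refine eq_of_eqOn_of_mem_constExtended (Γ.len_pos e) (oriented_mem_constExtended _ _) hu
    fun x hx => ?_
  rw [oriented_apply, edgeFun_of_mem _ _ (sub_mem_Icc_len hx)]
  simp only [ofOriented]
  split_ifs <;> simp

theorem ext_oriented (s : E → Bool) {f g : Γ.Fun}
    (h : ∀ e, Γ.oriented s e f = Γ.oriented s e g) : f = g := by
  funext e ⟨x, hx⟩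
  have := congrFun (h e) (if s e then x else Γ.len e - x)
  rw [oriented_apply, oriented_apply] at this
  rw [← edgeFun_of_mem f e hx, ← edgeFun_of_mem g e hx]
  split_ifs at this with h
  · exact this
  · simpa using this

theorem isEigenfunctionOn_oriented {μ : ℂ} {f : Γ.Fun} {e : E} :
    IsEigenfunctionOn (Γ.len e) μ (Γ.oriented s e f) ↔
      IsEigenfunctionOn (Γ.len e) μ (Γ.edgeFun f e) := by
  rw [oriented_eq]
  split_ifs
  · rfl
  · refine ⟨fun h => ?_, fun h => h.comp_const_sub (Γ.len_pos e)⟩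
    simpa using h.comp_const_sub (Γ.len_pos e)

open Classical in
theorem vertexValue_eq (f : Γ.Fun) (v : V) (e : Γ.Inc v) :
    Γ.vertexValue f v e =
      endValue (Γ.len e.1) (decide (Γ.start s e.1 = v)) (Γ.oriented s e.1 f) := by
  obtain ⟨e, he⟩ := e
  have := Γ.src_ne_tgt e
  cases hs : s e <;> simp only [vertexValue, endValue, oriented_eq, start, hs, sub_zero,
    decide_eq_true_eq, sub_self, Bool.false_eq_true, if_false, if_true]
  all_goals grind

open Classical in
theorem vertexDeriv_eq (f : Γ.Fun) (v : V) (e : Γ.Inc v) :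
    Γ.vertexDeriv f v e =
      endDeriv (Γ.len e.1) (decide (Γ.start s e.1 = v)) (Γ.oriented s e.1 f) := by
  obtain ⟨e, he⟩ := e
  have := Γ.src_ne_tgt e
  cases hs : s e <;> simp only [vertexDeriv, endDeriv, oriented_eq, start, hs, decide_eq_true_eq]
  · simp only [Bool.false_eq_true, if_false, derivWithin_Icc_comp_const_sub, sub_zero, sub_self]
    grind
  · grind

end MetricGraph

namespace EdgeCombination

variable {V₁ E₁ V₂ E₂ : Type*} [Finite E₁] {Γ₁ : MetricGraph V₁ E₁} {Γ₂ : MetricGraph V₂ E₂}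

/-- In oriented coordinates no reversals are needed, if they are recorded in accordance with the
orientations. -/
theorem oriented_toLinearMap (T : EdgeCombination Γ₁ Γ₂) {s₁ : E₁ → Bool} {s₂ : E₂ → Bool}
    (hT : ∀ e₂ e₁, T.reversed e₂ e₁ = (s₁ e₁ != s₂ e₂)) (f : Γ₁.Fun) (e₂ : E₂) :
    letI := Fintype.ofFinite E₁
    Γ₂.oriented s₂ e₂ (T.toLinearMap f) = ∑ e₁, T.coeff e₂ e₁ • Γ₁.oriented s₁ e₁ f := by
  refine eq_of_eqOn_of_mem_constExtended (Γ₂.len_pos e₂)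
    (MetricGraph.oriented_mem_constExtended _ _) (Submodule.sum_mem _ fun e₁ _ => ?_)
    fun x hx => ?_
  · by_cases h : T.coeff e₂ e₁ = 0
    · rw [h, zero_smul]
      exact Submodule.zero_mem _
    · rw [← T.len_eq e₂ e₁ h]
      exact Submodule.smul_mem _ _ (MetricGraph.oriented_mem_constExtended _ _)
  · rw [MetricGraph.oriented_apply,
      MetricGraph.edgeFun_of_mem _ _ (MetricGraph.sub_mem_Icc_len hx)]
    simp only [toLinearMap, LinearMap.coe_mk, AddHom.coe_mk, Finset.sum_apply, Pi.smul_apply,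
      smul_eq_mul, MetricGraph.oriented_apply]
    refine Finset.sum_congr rfl fun e₁ _ => ?_
    by_cases h : T.coeff e₂ e₁ = 0
    · rw [h, zero_mul, zero_mul]
    · rw [T.len_eq e₂ e₁ h, hT]
      cases s₁ e₁ <;> cases s₂ e₂ <;> simp

end EdgeCombination

section Orientation

variable {V E G : Type*} [Group G] [MulAction G V] [MulAction G E]

theorem orbitOf_smul {X : Type*} [MulAction G X] (g : G) (x : X) :
    orbitOf G (g • x) = orbitOf G x :=
  Quotient.sound (MulAction.orbitRel_apply.mpr ⟨g, rfl⟩)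

omit [MulAction G E] in
theorem orbitOf_src_ne_tgt {Γ : MetricGraph V E} (hG : ∀ (g : G) (e : E), g • Γ.src e ≠ Γ.tgt e)
    (e : E) : orbitOf G (Γ.src e) ≠ orbitOf G (Γ.tgt e) := by
  intro h
  obtain ⟨g, hg⟩ := MulAction.orbitRel_apply.mp (Quotient.exact h.symm)
  exact hG g e hg

/-- After the reversal of all edges with `s e = false`, the group preserves the directions of the
edges. -/
def IsInvariantOrientation (G : Type*) {V E : Type*} [Group G] [MulAction G V] [MulAction G E]
    (Γ : MetricGraph V E) (s : E → Bool) : Prop :=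
  ∀ (g : G) (e : E), Γ.src (g • e) = g • Γ.src e ↔ s (g • e) = s e

variable {s : E → Bool}

theorem IsInvariantOrientation.restrict {Γ : MetricGraph V E}
    (hs : IsInvariantOrientation G Γ s) (H : Subgroup G) : IsInvariantOrientation H Γ s :=
  fun h e => hs (h : G) e

variable [Finite E] {Γ : QuantumGraph V E}

theorem QuantumGraph.IsAction.restrict (hΓ : Γ.IsAction G) (H : Subgroup G) : Γ.IsAction H where
  ends h := hΓ.ends (h : G)
  len h := hΓ.len (h : G)
  boundary h := hΓ.boundary (h : G)

theorem QuantumGraph.IsAction.src_smul (hΓ : Γ.IsAction G) (g : G) (e : E) :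
    (Γ.src (g • e) = g • Γ.src e ∧ Γ.tgt (g • e) = g • Γ.tgt e) ∨
      (Γ.src (g • e) = g • Γ.tgt e ∧ Γ.tgt (g • e) = g • Γ.src e) := by
  simpa using hΓ.ends g e

/-- As no vertex is equivalent to one of its neighbours, all edges of an orbit can be directed
away from one and the same orbit of vertices. -/
theorem exists_isInvariantOrientation (hΓ : Γ.IsAction G)
    (hG : ∀ (g : G) (e : E), g • Γ.src e ≠ Γ.tgt e) :
    ∃ s : E → Bool, IsInvariantOrientation G Γ.toMetricGraph s := by
  classical
  let r (e : E) : E := (orbitOf G e).out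
  have hr : ∀ e, ∃ a : G, a • e = r e := fun e =>
    MulAction.orbitRel_apply.mp (Quotient.mk_out (s := MulAction.orbitRel G E) e)
  -- an edge keeps its direction if its source is equivalent to that of the chosen edge of its orbit
  refine ⟨fun e => decide (orbitOf G (Γ.src e) = orbitOf G (Γ.src (r e))), fun g e => ?_⟩
  have hrg : r (g • e) = r e := by simp only [r, orbitOf_smul]
  obtain ⟨a, ha⟩ := hr e
  have h1 := orbitOf_src_ne_tgt hG e
  have h2 : orbitOf G (Γ.src (r e)) = orbitOf G (Γ.src e) ∨
      orbitOf G (Γ.src (r e)) = orbitOf G (Γ.tgt e) := by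
    rw [← ha]
    rcases hΓ.src_smul a e with h | h <;> rw [h.1, orbitOf_smul] <;> simp
  have h3 : Γ.src (g • e) = g • Γ.src e ↔ orbitOf G (Γ.src (g • e)) = orbitOf G (Γ.src e) := by
    refine ⟨fun h => by rw [h, orbitOf_smul], fun h => ?_⟩
    rcases hΓ.src_smul g e with h' | h'
    · exact h'.1
    · rw [h'.1, orbitOf_smul] at h
      exact absurd h.symm h1
  have h4 : orbitOf G (Γ.src (g • e)) = orbitOf G (Γ.src e) ∨
      orbitOf G (Γ.src (g • e)) = orbitOf G (Γ.tgt e) := by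
    rcases hΓ.src_smul g e with h' | h' <;> rw [h'.1, orbitOf_smul] <;> simp
  simp only [h3, hrg]
  grind

namespace IsInvariantOrientation

variable (hs : IsInvariantOrientation G Γ.toMetricGraph s) (hΓ : Γ.IsAction G)
include hs hΓ

theorem start_smul (g : G) (e : E) : Γ.start s (g • e) = g • Γ.start s e := by
  have h1 := hs g e
  rcases hΓ.src_smul g e with h | h
  · simp only [MetricGraph.start, h1.mp h.1, h, smul_ite]
  · have h2 : s (g • e) ≠ s e := fun h2 =>
      Γ.src_ne_tgt e (MulAction.injective g ((h1.mpr h2).symm.trans h.1))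
    have h3 : s (g • e) = !s e := Bool.eq_not.mpr h2
    rw [MetricGraph.start, MetricGraph.start, h3, h.1, h.2]
    cases s e <;> rfl

theorem oriented_act (g : G) (f : Γ.Fun) (e : E) :
    Γ.oriented s e (Γ.act g f) = Γ.oriented s (g⁻¹ • e) f := by
  have hl : Γ.len (g⁻¹ • e) = Γ.len e := hΓ.len g⁻¹ e
  refine eq_of_eqOn_of_mem_constExtended (Γ.len_pos e)
    (MetricGraph.oriented_mem_constExtended _ _)
    (hl ▸ MetricGraph.oriented_mem_constExtended _ _) fun x hx => ?_
  rw [MetricGraph.oriented_apply, MetricGraph.edgeFun_of_mem _ _ (MetricGraph.sub_mem_Icc_len hx)]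
  simp only [QuantumGraph.act, MetricGraph.oriented_apply, hs g⁻¹ e, hl]
  cases s e <;> cases s (g⁻¹ • e) <;> simp

end IsInvariantOrientation

end Orientation

end

/-! ### Encoding and decoding -/

noncomputable section

variable {V E G W : Type*} [Finite E] [Group G] [MulAction G V] [MulAction G E]
  [AddCommGroup W] [Module ℂ W]

/-- `Ψ` is an intertwiner from `ρ` to the functions on the graph. The values are arbitrary functions,
not only eigenfunctions. -/
def IsEquivariant {Γ : QuantumGraph V E} (ρ : Representation ℂ G W) (Ψ : W →ₗ[ℂ] Γ.Fun) : Prop :=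
  ∀ (g : G) (w : W), Ψ (ρ g w) = Γ.act g (Ψ w)

section

variable {Γ : QuantumGraph V E} {ρ : Representation ℂ G W} {Ψ : W →ₗ[ℂ] Γ.Fun} {s : E → Bool}

theorem isEquivariant_iff (hΓ : Γ.IsAction G) (hs : IsInvariantOrientation G Γ.toMetricGraph s) :
    IsEquivariant ρ Ψ ↔
      ∀ g w e, Γ.oriented s e (Ψ (ρ g w)) = Γ.oriented s (g⁻¹ • e) (Ψ w) := by
  refine ⟨fun h g w e => by rw [h g w, hs.oriented_act hΓ], fun h g w => ?_⟩
  exact MetricGraph.ext_oriented s fun e => by rw [h g w e, hs.oriented_act hΓ]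

end

namespace QuotientChoice

variable {Γ : QuantumGraph V E} {ρ : Representation ℂ G W} (c : QuotientChoice Γ ρ)
  {hG : ∀ (g : G) (e : E), g • Γ.src e ≠ Γ.tgt e} (s : E → Bool)

/-- The indices `j` of the edges `e^i_j` over the `i`-th orbit of edges. -/
abbrev Index (i : MulAction.orbitRel.Quotient G E) : Type :=
  {j : Fin (Module.finrank ℂ W) //
    (j : ℕ) < Module.finrank ℂ (trivialComponent ρ (MulAction.stabilizer G (c.edgeRep i)))}

/-- The edge `e^i_j` of the quotient graph. -/
def edge (i : MulAction.orbitRel.Quotient G E) (j : c.Index i) : c.Edge := ⟨i, j⟩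

/-- The orientation of the edges of the quotient graph by that of their representatives. -/
def quotientOrientation (p : c.Edge) : Bool := s (c.edgeRep p.1)

omit [Finite E] in
theorem exists_smul_edgeRep (e : E) : ∃ g : G, g • c.edgeRep (orbitOf G e) = e :=
  MulAction.orbitRel_apply.mp (Quotient.exact (c.edgeRep_spec (orbitOf G e)).symm)

/-- A group element which carries the edge representative to the given edge. -/
def moveTo (e : E) : G := (c.exists_smul_edgeRep e).choose

omit [Finite E] in
theorem moveTo_smul (e : E) : c.moveTo e • c.edgeRep (orbitOf G e) = e :=
  (c.exists_smul_edgeRep e).choose_spec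

/-- The decoding of a function on the quotient graph: the intertwiner `Ψ` with this encoding. On
the edge `g ẽ^i`, `Ψ w` is `Ψ (ρ g⁻¹ w)` on `ẽ^i`, whose coordinates in the basis of the edge are
to be paired with the given function on the edges `e^i_j`. -/
def decode (r : c.RowChoice hG) (s : E → Bool) (f : (c.quotient r).Fun) : W →ₗ[ℂ] Γ.Fun where
  toFun w := Γ.ofOriented s fun e => ∑ j : c.Index (orbitOf G e),
    (c.edgeBasis (orbitOf G e)).coord j.1 (ρ (c.moveTo e)⁻¹ w) •
      (c.quotient r).oriented (c.quotientOrientation s) (c.edge (orbitOf G e) j) f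
  map_add' v w := by
    funext e x
    simp only [MetricGraph.ofOriented, map_add, add_smul, Finset.sum_add_distrib, Pi.add_apply]
  map_smul' a w := by
    funext e x
    simp only [MetricGraph.ofOriented, map_smul, smul_assoc, ← Finset.smul_sum, Pi.smul_apply,
      RingHom.id_apply]

variable {c s}

theorem oriented_encode (r : c.RowChoice hG) (Ψ : W →ₗ[ℂ] Γ.Fun)
    (i : MulAction.orbitRel.Quotient G E) (j : c.Index i) :
    (c.quotient r).oriented (c.quotientOrientation s) (c.edge i j) (c.encode r Ψ) =
      Γ.oriented s (c.edgeRep i) (Ψ (c.edgeBasis i j.1)) := rfl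

section

variable [Finite G]

omit [Finite E] in
theorem coord_apply_of_mem_stabilizer (i : MulAction.orbitRel.Quotient G E) (j : c.Index i) {k : G}
    (hk : k ∈ MulAction.stabilizer G (c.edgeRep i)) (w : W) :
    (c.edgeBasis i).coord j.1 (ρ k w) = (c.edgeBasis i).coord j.1 w :=
  coord_eq_of_mem_subgroup ρ _ (c.edgeBasis i) _ (c.edgeBasis_trivial i)
    (c.edgeBasis_nontrivial i) j.2 hk w

omit [Finite E] in
theorem apply_edgeBasis_eq_zero {M : Type*} [AddCommGroup M] [Module ℂ M]
    (i : MulAction.orbitRel.Quotient G E) (L : W →ₗ[ℂ] M)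
    (hL : ∀ k ∈ MulAction.stabilizer G (c.edgeRep i), ∀ w, L (ρ k w) = L w)
    {j : Fin (Module.finrank ℂ W)}
    (hj : Module.finrank ℂ (trivialComponent ρ (MulAction.stabilizer G (c.edgeRep i))) ≤ (j : ℕ)) :
    L (c.edgeBasis i j) = 0 :=
  map_eq_zero_of_mem_nontrivialComponent ρ _ L hL (c.edgeBasis_nontrivial i j hj)

omit [Finite E] in
/-- A linear map which does not change under the stabilizer of the edge representative is
determined by its values on the trivial component. -/
theorem sum_coord_smul_eq {M : Type*} [AddCommGroup M] [Module ℂ M]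
    (i : MulAction.orbitRel.Quotient G E) (L : W →ₗ[ℂ] M)
    (hL : ∀ k ∈ MulAction.stabilizer G (c.edgeRep i), ∀ w, L (ρ k w) = L w) (w : W) :
    ∑ j : c.Index i, (c.edgeBasis i).coord j.1 w • L (c.edgeBasis i j.1) = L w := by
  conv_rhs => rw [← (c.edgeBasis i).sum_repr w, map_sum]
  rw [← Finset.sum_subtype (Finset.univ.filter fun j : Fin (Module.finrank ℂ W) => (j : ℕ) <
      Module.finrank ℂ (trivialComponent ρ (MulAction.stabilizer G (c.edgeRep i)))) (by simp)
    (fun j => (c.edgeBasis i).coord j w • L (c.edgeBasis i j))]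
  refine (Finset.sum_subset (Finset.subset_univ _) fun j _ hj => ?_).trans
    (Finset.sum_congr rfl fun j _ => (map_smul L _ _).symm)
  rw [apply_edgeBasis_eq_zero i L hL (by simpa using hj), smul_zero]

variable (hΓ : Γ.IsAction G) (hs : IsInvariantOrientation G Γ.toMetricGraph s)
include hΓ

/-- The decoding does not depend on the group elements which carry edge representatives to
edges. -/
theorem oriented_decode (r : c.RowChoice hG) (f : (c.quotient r).Fun) (w : W) {e : E}
    {i : MulAction.orbitRel.Quotient G E} {g : G} (hg : g • c.edgeRep i = e) :
    Γ.oriented s e (c.decode r s f w) =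
      ∑ j : c.Index i, (c.edgeBasis i).coord j.1 (ρ g⁻¹ w) •
        (c.quotient r).oriented (c.quotientOrientation s) (c.edge i j) f := by
  obtain rfl : orbitOf G e = i := by rw [← hg, orbitOf_smul, c.edgeRep_spec]
  have hm := c.moveTo_smul e
  have hlen : Γ.len (c.edgeRep (orbitOf G e)) = Γ.len e := by rw [← hΓ.len (c.moveTo e), hm]
  refine (MetricGraph.oriented_ofOriented (fun e => ∑ j : c.Index (orbitOf G e),
    (c.edgeBasis (orbitOf G e)).coord j.1 (ρ (c.moveTo e)⁻¹ w) •
      (c.quotient r).oriented (c.quotientOrientation s) (c.edge (orbitOf G e) j) f)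
    (Submodule.sum_mem _ fun j _ =>
    Submodule.smul_mem _ _ ?_)).trans (Finset.sum_congr rfl fun j _ => ?_)
  · rw [← hlen]
    exact MetricGraph.oriented_mem_constExtended f (c.edge (orbitOf G e) j)
  · have hk : (c.moveTo e)⁻¹ * g ∈ MulAction.stabilizer G (c.edgeRep (orbitOf G e)) := by
      rw [MulAction.mem_stabilizer_iff, mul_smul, hg, inv_smul_eq_iff, hm]
    have := coord_apply_of_mem_stabilizer _ j hk (ρ g⁻¹ w)
    rw [← Module.End.mul_apply, ← map_mul, mul_inv_cancel_right] at this
    rw [this]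

include hs

theorem isEquivariant_decode (r : c.RowChoice hG) (f : (c.quotient r).Fun) :
    IsEquivariant ρ (c.decode r s f) := by
  refine (isEquivariant_iff hΓ hs).mpr fun g w e => ?_
  have hm := c.moveTo_smul e
  have hm' : (g⁻¹ * c.moveTo e) • c.edgeRep (orbitOf G e) = g⁻¹ • e := by rw [mul_smul, hm]
  rw [oriented_decode hΓ r f _ hm, oriented_decode hΓ r f _ hm', ← Module.End.mul_apply, ← map_mul,
    mul_inv_rev, inv_inv]

omit hs in
theorem encode_decode (r : c.RowChoice hG) (f : (c.quotient r).Fun) :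
    c.encode r (c.decode r s f) = f := by
  refine MetricGraph.ext_oriented (Γ := c.metricGraph hG) (c.quotientOrientation s) ?_
  rintro ⟨i, j⟩
  change (c.quotient r).oriented _ (c.edge i j) _ = (c.quotient r).oriented _ (c.edge i j) _
  rw [oriented_encode, oriented_decode hΓ r f _ (one_smul G (c.edgeRep i)),
    Finset.sum_eq_single j]
  · simp
  · intro j' _ hj'
    have : j.1 ≠ j'.1 := fun h => hj' (Subtype.ext h.symm)
    simp [this]
  · simp

omit [Finite G] in
theorem oriented_apply_stabilizer {Ψ : W →ₗ[ℂ] Γ.Fun} (hΨ : IsEquivariant ρ Ψ) {e : E} {k : G}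
    (hk : k ∈ MulAction.stabilizer G e) (w : W) :
    Γ.oriented s e (Ψ (ρ k w)) = Γ.oriented s e (Ψ w) := by
  rw [(isEquivariant_iff hΓ hs).mp hΨ, MulAction.mem_stabilizer_iff.mp (inv_mem hk)]

theorem decode_encode (r : c.RowChoice hG) {Ψ : W →ₗ[ℂ] Γ.Fun} (hΨ : IsEquivariant ρ Ψ) :
    c.decode r s (c.encode r Ψ) = Ψ := by
  ext1 w
  refine MetricGraph.ext_oriented s fun e => ?_
  have hm := c.moveTo_smul e
  rw [oriented_decode hΓ r _ _ hm]
  simp only [oriented_encode]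
  refine (sum_coord_smul_eq (orbitOf G e) (Γ.oriented s (c.edgeRep (orbitOf G e)) ∘ₗ Ψ)
    (fun k hk w => oriented_apply_stabilizer hΓ hs hΨ hk w) _).trans ?_
  rw [LinearMap.comp_apply, (isEquivariant_iff hΓ hs).mp hΨ, inv_inv, hm]

end

end QuotientChoice

end

/-! ### Boundary conditions and eigenspaces -/

noncomputable section

variable {V E G W : Type*} [Finite E] [Group G] [MulAction G V] [MulAction G E]
  [AddCommGroup W] [Module ℂ W]

section Traces

variable {Γ : QuantumGraph V E} {s : E → Bool}

open Classical in
/-- The value of `f` at the vertex `v` along the incident edge `e`, read in oriented coordinates. For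
an edge not incident to `v` it has no meaning. -/
def incValue (Γ : MetricGraph V E) (s : E → Bool) (f : Γ.Fun) (v : V) (e : E) : ℂ :=
  endValue (Γ.len e) (decide (Γ.start s e = v)) (Γ.oriented s e f)

open Classical in
/-- The outgoing derivative of `f` at the vertex `v` along the incident edge `e`, read in oriented
coordinates. For an edge not incident to `v` it has no meaning. -/
def incDeriv (Γ : MetricGraph V E) (s : E → Bool) (f : Γ.Fun) (v : V) (e : E) : ℂ :=
  endDeriv (Γ.len e) (decide (Γ.start s e = v)) (Γ.oriented s e f)

/-- Membership in the eigenspace in oriented coordinates. -/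
theorem mem_eigenspace_iff {μ : ℂ} {f : Γ.Fun} : f ∈ Γ.eigenspace μ ↔
    (∀ e, IsEigenfunctionOn (Γ.len e) μ (Γ.oriented s e f)) ∧
    ∀ v, Γ.BoundaryCondition v (fun e => incValue Γ.toMetricGraph s f v e.1)
      (fun e => incDeriv Γ.toMetricGraph s f v e.1) := by
  refine and_congr (forall_congr' fun e => MetricGraph.isEigenfunctionOn_oriented.symm)
    (forall_congr' fun v => ?_)
  rw [funext (MetricGraph.vertexValue_eq (s := s) f v),
    funext (MetricGraph.vertexDeriv_eq (s := s) f v)]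
  rfl

theorem boundaryCondition_act (hΓ : Γ.IsAction G)
    (hs : IsInvariantOrientation G Γ.toMetricGraph s) (g : G) {f : Γ.Fun} {v : V}
    (h : Γ.BoundaryCondition v (fun e => incValue Γ.toMetricGraph s f v e.1)
      (fun e => incDeriv Γ.toMetricGraph s f v e.1)) :
    Γ.BoundaryCondition (g • v)
      (fun e => incValue Γ.toMetricGraph s (Γ.act g f) (g • v) e.1)
      (fun e => incDeriv Γ.toMetricGraph s (Γ.act g f) (g • v) e.1) := by
  have hst : ∀ e, Γ.start s (g⁻¹ • e) = v ↔ Γ.start s e = g • v := fun e => by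
    rw [hs.start_smul hΓ, inv_smul_eq_iff]
  have h₀ : ∀ e, incValue Γ.toMetricGraph s f v (g⁻¹ • e) =
      incValue Γ.toMetricGraph s (Γ.act g f) (g • v) e := fun e => by
    rw [incValue, incValue, hs.oriented_act hΓ, hΓ.len, decide_eq_decide.mpr (hst e)]
  have h₁ : ∀ e, incDeriv Γ.toMetricGraph s f v (g⁻¹ • e) =
      incDeriv Γ.toMetricGraph s (Γ.act g f) (g • v) e := fun e => by
    rw [incDeriv, incDeriv, hs.oriented_act hΓ, hΓ.len, decide_eq_decide.mpr (hst e)]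
  have hbc := hΓ.boundary g v _ _ h
  simp only [h₀, h₁] at hbc
  exact hbc

theorem act_mem_eigenspace (hΓ : Γ.IsAction G)
    (hs : IsInvariantOrientation G Γ.toMetricGraph s) (g : G) {μ : ℂ} {f : Γ.Fun}
    (hf : f ∈ Γ.eigenspace μ) : Γ.act g f ∈ Γ.eigenspace μ := by
  rw [mem_eigenspace_iff (s := s)] at hf ⊢
  refine ⟨fun e => ?_, fun v => ?_⟩
  · rw [hs.oriented_act hΓ, ← hΓ.len g⁻¹ e]
    exact hf.1 _
  · have := boundaryCondition_act hΓ hs g (hf.2 (g⁻¹ • v))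
    rwa [smul_inv_smul] at this

/-- The eigenspace as a subspace of the space of functions. -/
def eigenSubmodule (Γ : QuantumGraph V E) (μ : ℂ) : Submodule ℂ Γ.Fun where
  carrier := Γ.eigenspace μ
  zero_mem' := by
    have h : ∀ e, Γ.edgeFun (0 : Γ.Fun) e = 0 := fun _ => rfl
    rw [mem_eigenspace_iff (s := fun _ => true)]
    refine ⟨fun e => ?_, fun v => ?_⟩
    · rw [map_zero]
      exact IsEigenfunctionOn.zero
    · simp only [incValue, incDeriv, map_zero, endValue, endDeriv, Pi.zero_apply, ite_self,
        derivWithin_zero, neg_zero]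
      change (Γ.A v).mulVec 0 + (Γ.B v).mulVec 0 = 0
      rw [Matrix.mulVec_zero, Matrix.mulVec_zero, add_zero]
  add_mem' {f g} hf hg := by
    rw [mem_eigenspace_iff (s := fun _ => true)] at hf hg ⊢
    refine ⟨fun e => ?_, fun v => ?_⟩
    · rw [map_add]
      exact (hf.1 e).add (Γ.len_pos e) (hg.1 e)
    · have h := congrArg₂ (· + ·) (hf.2 v) (hg.2 v)
      simp only [add_zero] at h
      rw [add_add_add_comm, ← Matrix.mulVec_add, ← Matrix.mulVec_add] at h
      refine Eq.trans (congrArg₂ (· + ·) (congrArg _ (funext fun e => ?_))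
        (congrArg _ (funext fun e => ?_))) h
      · rw [incValue, map_add]
        exact endValue_add _ _ _ _
      · rw [incDeriv, map_add]
        exact endDeriv_add (Γ.len_pos _) _ (hf.1 _).differentiableOn (hg.1 _).differentiableOn
  smul_mem' a f hf := by
    rw [mem_eigenspace_iff (s := fun _ => true)] at hf ⊢
    refine ⟨fun e => ?_, fun v => ?_⟩
    · rw [map_smul]
      exact (hf.1 e).smul (Γ.len_pos e) a
    · have h := congrArg (a • ·) (hf.2 v)
      simp only [smul_zero, smul_add, ← Matrix.mulVec_smul] at h
      refine Eq.trans (congrArg₂ (· + ·) (congrArg _ (funext fun e => ?_))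
        (congrArg _ (funext fun e => ?_))) h
      · rw [incValue, map_smul]
        exact endValue_smul _ _ _ _
      · rw [incDeriv, map_smul]
        exact endDeriv_smul (Γ.len_pos _) _ a (hf.1 _).differentiableOn

theorem boundaryCondition_linearMap_of_basis {v : V} {ι : Type*} (b : Module.Basis ι ℂ W)
    {x y : Γ.Inc v → W →ₗ[ℂ] ℂ}
    (h : ∀ i, Γ.BoundaryCondition v (fun e => x e (b i)) (fun e => y e (b i))) (w : W) :
    Γ.BoundaryCondition v (fun e => x e w) (fun e => y e w) := by
  let L : W →ₗ[ℂ] (Γ.Row v → ℂ) :=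
    (Γ.A v).mulVecLin ∘ₗ LinearMap.pi x + (Γ.B v).mulVecLin ∘ₗ LinearMap.pi y
  have hL : L = 0 := b.ext fun i => h i
  exact LinearMap.congr_fun hL w

end Traces

namespace QuotientChoice

variable {Γ : QuantumGraph V E} {ρ : Representation ℂ G W} {c : QuotientChoice Γ ρ}
  {hG : ∀ (g : G) (e : E), g • Γ.src e ≠ Γ.tgt e} {s : E → Bool}

/-- At an edge incident to a vertex representative, the end at this vertex corresponds to the end
of the edge representative at the vertex of the quotient graph. -/
theorem orbitOf_start_edgeRep_iff (hΓ : Γ.IsAction G)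
    (hs : IsInvariantOrientation G Γ.toMetricGraph s)
    (hG : ∀ (g : G) (e : E), g • Γ.src e ≠ Γ.tgt e)
    (k : MulAction.orbitRel.Quotient G V) (e : Γ.Inc (c.vertexRep k)) :
    orbitOf G (Γ.start s (c.edgeRep (orbitOf G e.1))) = k ↔ Γ.start s e.1 = c.vertexRep k := by
  have h1 := orbitOf_src_ne_tgt (Γ := Γ.toMetricGraph) hG e.1
  have h2 : orbitOf G (Γ.start s (c.edgeRep (orbitOf G e.1))) = orbitOf G (Γ.start s e.1) := by
    rw [← orbitOf_smul (c.move k e), ← hs.start_smul hΓ, c.move_spec]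
  rw [h2]
  have hv := c.vertexRep_spec k
  obtain ⟨e, he⟩ := e
  generalize c.vertexRep k = v at he hv ⊢
  refine ⟨fun h => ?_, fun h => by rw [h, hv]⟩
  rw [← hv] at h
  unfold MetricGraph.start at h ⊢
  rcases he with rfl | rfl <;> cases hse : s e <;>
    simp only [hse, Bool.false_eq_true, if_false, if_true] at h ⊢
  · exact absurd h.symm h1
  · exact absurd h h1

theorem inc_edgeRep (hΓ : Γ.IsAction G) (k : MulAction.orbitRel.Quotient G V)
    (e : Γ.Inc (c.vertexRep k)) : orbitOf G (Γ.src (c.edgeRep (orbitOf G e.1))) = k ∨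
      orbitOf G (Γ.tgt (c.edgeRep (orbitOf G e.1))) = k := by
  have h1 := hΓ.src_smul (c.move k e) (c.edgeRep (orbitOf G e.1))
  rw [c.move_spec] at h1
  have h2 : orbitOf G (Γ.src e.1) = k ∨ orbitOf G (Γ.tgt e.1) = k :=
    e.2.imp (fun h => by rw [h, c.vertexRep_spec]) (fun h => by rw [h, c.vertexRep_spec])
  rcases h1 with h | h <;> rw [h.1, h.2, orbitOf_smul, orbitOf_smul] at h2
  · exact h2
  · exact h2.symm

open Classical in
/-- The factor `Θ` distributes the values on the edges `e^i_j` to all edges incident to the vertex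
representative. Where there is no edge `e^i_j`, the vector `b^i_j` lies in the nontrivial
component, where the invariant functional vanishes. -/
theorem thetaMatrix_mulVec [Finite G] (hΓ : Γ.IsAction G) {k : MulAction.orbitRel.Quotient G V}
    {t : E → Bool → W →ₗ[ℂ] ℂ} (ht : ∀ g e b w, t (g • e) b (ρ g w) = t e b w)
    {x : (c.metricGraph hG).Inc k → ℂ}
    (hx : ∀ p, x p = t (c.edgeRep p.1.1)
      (decide (orbitOf G (Γ.start s (c.edgeRep p.1.1)) = k)) (c.edgeBasis p.1.1 p.1.2.1))
    (e : Γ.Inc (c.vertexRep k)) (j : Fin (Module.finrank ℂ W)) :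
    (c.thetaMatrix hG k).mulVec x (e, j) = t (c.edgeRep (orbitOf G e.1))
      (decide (orbitOf G (Γ.start s (c.edgeRep (orbitOf G e.1))) = k))
      (c.edgeBasis (orbitOf G e.1) j) := by
  have hsum : (c.thetaMatrix hG k).mulVec x (e, j) =
      ∑ p, (if orbitOf G e.1 = p.1.1 ∧ j = p.1.2.1 then 1 else 0) * x p := rfl
  rw [hsum]
  by_cases hj : (j : ℕ) < Module.finrank ℂ
      (trivialComponent ρ (MulAction.stabilizer G (c.edgeRep (orbitOf G e.1))))
  · let p₀ : (c.metricGraph hG).Inc k :=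
      ⟨c.edge (orbitOf G e.1) ⟨j, hj⟩, inc_edgeRep hΓ k e⟩
    rw [Finset.sum_eq_single p₀]
    · rw [if_pos ⟨rfl, rfl⟩, one_mul, hx]
      rfl
    · rintro ⟨⟨i, j'⟩, hp⟩ _ hne
      rw [if_neg, zero_mul]
      rintro ⟨rfl, rfl⟩
      exact hne rfl
    · exact fun h => absurd (Finset.mem_univ _) h
  · rw [apply_edgeBasis_eq_zero _ (t (c.edgeRep (orbitOf G e.1)) _) _ (not_lt.mp hj)]
    · refine Finset.sum_eq_zero fun p _ => ?_
      rw [if_neg, zero_mul]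
      rintro ⟨h, rfl⟩
      rw [h] at hj
      exact hj p.1.2.2
    · intro g hg w
      have := ht g (c.edgeRep (orbitOf G e.1))
        (decide (orbitOf G (Γ.start s (c.edgeRep (orbitOf G e.1))) = k)) w
      rwa [MulAction.mem_stabilizer_iff.mp hg] at this

open Classical in
/-- The matrices of the quotient graph, applied to the values (or derivatives) of an encoded
intertwiner, give the matrices of the original graph, applied to the values (or derivatives) of
the images of the elements of the global basis. -/
theorem kronecker_mul_mulVec [Finite G] (hΓ : Γ.IsAction G)
    (hs : IsInvariantOrientation G Γ.toMetricGraph s) {k : MulAction.orbitRel.Quotient G V}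
    {t : E → Bool → W →ₗ[ℂ] ℂ} (ht : ∀ g e b w, t (g • e) b (ρ g w) = t e b w)
    {x : (c.metricGraph hG).Inc k → ℂ}
    (hx : ∀ p, x p = t (c.edgeRep p.1.1)
      (decide (orbitOf G (Γ.start s (c.edgeRep p.1.1)) = k)) (c.edgeBasis p.1.1 p.1.2.1))
    {R : Type*} (M : Matrix R (Γ.Inc (c.vertexRep k)) ℂ) (r : R)
    (m : Fin (Module.finrank ℂ W)) :
    (M ⊗ₖ (1 : Matrix (Fin (Module.finrank ℂ W)) (Fin (Module.finrank ℂ W)) ℂ) *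
      c.blockMatrix k * c.thetaMatrix hG k).mulVec x (r, m) =
    M.mulVec (fun e => t e.1 (decide (Γ.start s e.1 = c.vertexRep k)) (c.basis m)) r := by
  have hD : ∀ e m, (c.blockMatrix k).mulVec ((c.thetaMatrix hG k).mulVec x) (e, m) =
      t e.1 (decide (Γ.start s e.1 = c.vertexRep k)) (c.basis m) := by
    intro e m
    have hd : decide (orbitOf G (Γ.start s (c.edgeRep (orbitOf G e.1))) = k) =
        decide (Γ.start s e.1 = c.vertexRep k) := by
      simp only [orbitOf_start_edgeRep_iff hΓ hs hG]
    have h1 := ht (c.move k e) (c.edgeRep (orbitOf G e.1))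
      (decide (Γ.start s e.1 = c.vertexRep k)) (ρ (c.move k e)⁻¹ (c.basis m))
    rw [c.move_spec, Representation.self_inv_apply] at h1
    rw [h1, Matrix.mulVec, dotProduct, Fintype.sum_prod_type, Finset.sum_eq_single e]
    · simp only [blockMatrix, Matrix.of_apply, if_true, thetaMatrix_mulVec hΓ ht hx, hd]
      conv_rhs => rw [← (c.edgeBasis (orbitOf G e.1)).sum_repr (ρ (c.move k e)⁻¹ (c.basis m)),
        map_sum]
      refine Finset.sum_congr rfl fun j _ => ?_
      rw [map_smul, LinearMap.toMatrix_apply, smul_eq_mul]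
    · intro e' _ hne
      refine Finset.sum_eq_zero fun j _ => ?_
      simp only [blockMatrix, Matrix.of_apply, if_neg hne.symm, zero_mul]
    · exact fun h => absurd (Finset.mem_univ _) h
  rw [Matrix.mul_assoc, ← Matrix.mulVec_mulVec, ← Matrix.mulVec_mulVec, Matrix.mulVec, dotProduct,
    Fintype.sum_prod_type, Matrix.mulVec, dotProduct]
  refine Finset.sum_congr rfl fun e _ => ?_
  simp [hD, Matrix.kroneckerMap_apply, Matrix.one_apply]

variable [Finite G] (hΓ : Γ.IsAction G) (hs : IsInvariantOrientation G Γ.toMetricGraph s)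
include hΓ hs

theorem isEigenfunctionOn_oriented_of_encode (r : c.RowChoice hG) {Ψ : W →ₗ[ℂ] Γ.Fun}
    (hΨ : IsEquivariant ρ Ψ) {μ : ℂ}
    (h : ∀ i (j : c.Index i), IsEigenfunctionOn (Γ.len (c.edgeRep i)) μ
      (Γ.oriented s (c.edgeRep i) (Ψ (c.edgeBasis i j.1)))) (w : W) (e : E) :
    IsEigenfunctionOn (Γ.len e) μ (Γ.oriented s e (Ψ w)) := by
  have hm := c.moveTo_smul e
  have hlen : Γ.len e = Γ.len (c.edgeRep (orbitOf G e)) := by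
    rw [← hΓ.len (c.moveTo e) (c.edgeRep (orbitOf G e)), hm]
  rw [← decode_encode hΓ hs r hΨ, oriented_decode hΓ r _ w hm]
  exact IsEigenfunctionOn.sum (Γ.len_pos e) _ _ fun j _ => hlen ▸ h _ j

omit hΓ hs [Finite G] in
theorem start_quotient (r : c.RowChoice hG) (p : c.Edge) :
    (c.quotient r).start (c.quotientOrientation s) p =
      orbitOf G (Γ.start s (c.edgeRep p.1)) := by
  have h : Γ.start s (c.edgeRep p.1) = if s (c.edgeRep p.1) then Γ.src (c.edgeRep p.1)
    else Γ.tgt (c.edgeRep p.1) := rfl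
  rw [h, apply_ite (orbitOf G)]
  rfl

omit hΓ hs [Finite G] in
/-- The elimination of rows does not change the boundary conditions. -/
theorem boundaryCondition_quotient_iff (r : c.RowChoice hG) {k : MulAction.orbitRel.Quotient G V}
    {x y : (c.metricGraph hG).Inc k → ℂ} : (c.quotient r).BoundaryCondition k x y ↔
      (c.matrixA hG k).mulVec x + (c.matrixB hG k).mulVec y = 0 := by
  refine ⟨fun h => r.keep_spec k x y fun p hp => congrFun h ⟨p, hp⟩, fun h => ?_⟩
  funext p
  exact congrFun h p.1

/-- The value of `Ψ w` at an end of an edge, as a linear functional of `w`. -/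
def valueFunctional (s : E → Bool) (Ψ : W →ₗ[ℂ] Γ.Fun) (e : E) (b : Bool) : W →ₗ[ℂ] ℂ where
  toFun w := endValue (Γ.len e) b (Γ.oriented s e (Ψ w))
  map_add' v w := by rw [map_add, map_add]; exact endValue_add _ _ _ _
  map_smul' a w := by rw [map_smul, map_smul]; exact endValue_smul _ _ _ _

/-- The derivative of `Ψ w` at an end of an edge, as a linear functional of `w`. It is linear only
because the functions are differentiable up to the ends. -/
def derivFunctional (s : E → Bool) (Ψ : W →ₗ[ℂ] Γ.Fun)
    (hd : ∀ w e, DifferentiableOn ℝ (Γ.oriented s e (Ψ w)) (Icc 0 (Γ.len e))) (e : E) (b : Bool) :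
    W →ₗ[ℂ] ℂ where
  toFun w := endDeriv (Γ.len e) b (Γ.oriented s e (Ψ w))
  map_add' v w := by rw [map_add, map_add, endDeriv_add (Γ.len_pos e) b (hd v e) (hd w e)]
  map_smul' a w := by
    rw [map_smul, map_smul, endDeriv_smul (Γ.len_pos e) b a (hd w e)]
    rfl

omit [Finite G] in
theorem valueFunctional_smul {Ψ : W →ₗ[ℂ] Γ.Fun} (hΨ : IsEquivariant ρ Ψ) (g : G) (e : E)
    (b : Bool) (w : W) :
    valueFunctional s Ψ (g • e) b (ρ g w) = valueFunctional s Ψ e b w := by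
  change endValue _ _ _ = endValue _ _ _
  rw [(isEquivariant_iff hΓ hs).mp hΨ, inv_smul_smul, hΓ.len]

omit [Finite G] in
theorem derivFunctional_smul {Ψ : W →ₗ[ℂ] Γ.Fun} (hΨ : IsEquivariant ρ Ψ)
    (hd : ∀ w e, DifferentiableOn ℝ (Γ.oriented s e (Ψ w)) (Icc 0 (Γ.len e))) (g : G) (e : E)
    (b : Bool) (w : W) :
    derivFunctional s Ψ hd (g • e) b (ρ g w) = derivFunctional s Ψ hd e b w := by
  change endDeriv _ _ _ = endDeriv _ _ _
  rw [(isEquivariant_iff hΓ hs).mp hΨ, inv_smul_smul, hΓ.len]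

/-- The boundary condition at a vertex of the quotient graph, for the encoding of `Ψ`, is the
conjunction of the boundary conditions at the vertex representative for all functions `Ψ w`. -/
theorem boundaryCondition_encode_iff (r : c.RowChoice hG) {Ψ : W →ₗ[ℂ] Γ.Fun}
    (hΨ : IsEquivariant ρ Ψ)
    (hd : ∀ w e, DifferentiableOn ℝ (Γ.oriented s e (Ψ w)) (Icc 0 (Γ.len e)))
    (k : MulAction.orbitRel.Quotient G V) :
    (c.quotient r).BoundaryCondition k
      (fun p => incValue (c.quotient r).toMetricGraph (c.quotientOrientation s)
        (c.encode r Ψ) k p.1)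
      (fun p => incDeriv (c.quotient r).toMetricGraph (c.quotientOrientation s)
        (c.encode r Ψ) k p.1) ↔
    ∀ w, Γ.BoundaryCondition (c.vertexRep k)
      (fun e => incValue Γ.toMetricGraph s (Ψ w) (c.vertexRep k) e.1)
      (fun e => incDeriv Γ.toMetricGraph s (Ψ w) (c.vertexRep k) e.1) := by
  classical
  refine (boundaryCondition_quotient_iff r).trans ?_
  have hA := fun x hx => kronecker_mul_mulVec (hG := hG) (k := k) (x := x) hΓ hs
    (valueFunctional_smul hΓ hs hΨ) hx (Γ.A (c.vertexRep k))
  have hB := fun x hx => kronecker_mul_mulVec (hG := hG) (k := k) (x := x) hΓ hs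
    (derivFunctional_smul hΓ hs hΨ hd) hx (Γ.B (c.vertexRep k))
  have hA' := hA (fun p => incValue (c.quotient r).toMetricGraph (c.quotientOrientation s)
    (c.encode r Ψ) k p.1) fun p => by simp only [incValue, start_quotient]; rfl
  have hB' := hB (fun p => incDeriv (c.quotient r).toMetricGraph (c.quotientOrientation s)
    (c.encode r Ψ) k p.1) fun p => by simp only [incDeriv, start_quotient]; rfl
  constructor
  · intro h
    refine boundaryCondition_linearMap_of_basis c.basis
      (x := fun e => valueFunctional s Ψ e.1 (decide (Γ.start s e.1 = c.vertexRep k)))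
      (y := fun e => derivFunctional s Ψ hd e.1 (decide (Γ.start s e.1 = c.vertexRep k)))
      fun m => ?_
    funext q
    exact (congrArg₂ (· + ·) (hA' q m) (hB' q m)).symm.trans (congrFun h (q, m))
  · intro h
    funext ⟨q, m⟩
    exact (congrArg₂ (· + ·) (hA' q m) (hB' q m)).trans (congrFun (h (c.basis m)) q)

/-- An intertwiner takes its values in the eigenspace if and only if its encoding is an
eigenfunction on the quotient graph. -/
theorem encode_mem_eigenspace_iff (r : c.RowChoice hG) {Ψ : W →ₗ[ℂ] Γ.Fun}
    (hΨ : IsEquivariant ρ Ψ) {μ : ℂ} :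
    c.encode r Ψ ∈ (c.quotient r).eigenspace μ ↔ ∀ w, Ψ w ∈ Γ.eigenspace μ := by
  have hedge : (∀ p, IsEigenfunctionOn ((c.quotient r).len p) μ
      ((c.quotient r).oriented (c.quotientOrientation s) p (c.encode r Ψ))) ↔
      ∀ w e, IsEigenfunctionOn (Γ.len e) μ (Γ.oriented s e (Ψ w)) :=
    ⟨fun h => isEigenfunctionOn_oriented_of_encode hΓ hs r hΨ fun i j => h (c.edge i j),
      fun h p => h _ _⟩
  simp only [mem_eigenspace_iff (s := s)]
  rw [mem_eigenspace_iff (s := c.quotientOrientation s), hedge, forall_and]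
  refine and_congr_right fun heig => ?_
  have hrep := boundaryCondition_encode_iff hΓ hs r hΨ fun w e => (heig w e).differentiableOn
  refine (forall_congr' hrep).trans ⟨fun h w v => ?_, fun h k w => h w _⟩
  obtain ⟨g, hg⟩ : ∃ g : G, g • c.vertexRep (orbitOf G v) = v :=
    MulAction.orbitRel_apply.mp (Quotient.exact (c.vertexRep_spec (orbitOf G v)).symm)
  have hbc := boundaryCondition_act hΓ hs g (h (orbitOf G v) (ρ g⁻¹ w))
  rwa [← hΨ, Representation.self_inv_apply, hg] at hbc

end QuotientChoice

end

/-! ### Frobenius reciprocity and the transplantation -/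

noncomputable section

section Frobenius

open Representation

variable {G W M : Type*} [Group G] [AddCommGroup W] [Module ℂ W] [AddCommGroup M] [Module ℂ M]
  {H : Subgroup G} {R : Representation ℂ H W}

theorem indV_mk_smul (h : H) (g : G) (w : W) :
    IndV.mk H.subtype R (h * g) (R h w) = IndV.mk H.subtype R g w := by
  have := Coinvariants.mk_self_apply
    (Representation.tprod ((leftRegular ℂ G).comp H.subtype) R) h
    (TensorProduct.tmul ℂ (MonoidAlgebra.single g 1) w)
  simpa using this

theorem indV_mem_of_mk_mem {S : Submodule ℂ (IndV H.subtype R)}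
    (hS : ∀ g w, IndV.mk H.subtype R g w ∈ S) (w : IndV H.subtype R) : w ∈ S := by
  have : S.mkQ = 0 := IndV.hom_ext _ _ fun g => LinearMap.ext fun w => by
    simpa using hS g w
  exact (Submodule.Quotient.mk_eq_zero S).mp (LinearMap.congr_fun this w)

/-- The existence part of Frobenius reciprocity. -/
theorem exists_indV_lift (τ : Representation ℂ G M) (ψ : W →ₗ[ℂ] M)
    (hψ : ∀ (h : H) w, ψ (R h w) = τ h (ψ w)) :
    ∃ Ψ : IndV H.subtype R →ₗ[ℂ] M, ∀ g w, Ψ (IndV.mk H.subtype R g w) = τ g⁻¹ (ψ w) := by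
  refine ⟨Coinvariants.lift _ (TensorProduct.lift <|
    (Finsupp.lift _ _ _ fun g => τ g⁻¹ ∘ₗ ψ) ∘ₗ (MonoidAlgebra.coeffLinearEquiv ℂ).toLinearMap)
    fun h => ?_, fun g w => ?_⟩
  · ext g w
    simp [hψ]
  · simp

end Frobenius

section Transplantation

variable {V E G W : Type*} [Finite E] [Group G] [MulAction G V] [MulAction G E]
  {Γ : QuantumGraph V E} {s : E → Bool}

/-- The action of the group on functions as a representation. -/
def actRepresentation (hΓ : Γ.IsAction G) (hs : IsInvariantOrientation G Γ.toMetricGraph s) :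
    Representation ℂ G Γ.Fun where
  toFun g :=
    { toFun := Γ.act g
      map_add' := fun _ _ => rfl
      map_smul' := fun _ _ => rfl }
  map_one' := by
    ext1 f
    refine MetricGraph.ext_oriented s fun e => ?_
    exact (hs.oriented_act hΓ 1 f e).trans (by rw [inv_one, one_smul]; rfl)
  map_mul' g h := by
    ext1 f
    refine MetricGraph.ext_oriented s fun e => ?_
    change Γ.oriented s e (Γ.act (g * h) f) = Γ.oriented s e (Γ.act g (Γ.act h f))
    rw [hs.oriented_act hΓ, hs.oriented_act hΓ, hs.oriented_act hΓ, mul_inv_rev, mul_smul]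

variable [Finite G] [AddCommGroup W] [Module ℂ W] {H : Subgroup G} {R : Representation ℂ H W}

open Representation

omit [Finite E] [Finite G] in
/-- The restriction of an intertwiner to the inducing representation. -/
theorem isEquivariant_comp_mk {Ψ : IndV H.subtype R →ₗ[ℂ] Γ.Fun}
    (hΨ : IsEquivariant (ind H.subtype R) Ψ) :
    IsEquivariant (G := H) R (Ψ ∘ₗ IndV.mk H.subtype R 1) := by
  intro h w
  have h1 : IndV.mk H.subtype R 1 (R h w) = ind H.subtype R h (IndV.mk H.subtype R 1 w) := by
    rw [ind_mk, one_mul, ← indV_mk_smul h (h : G)⁻¹ w, mul_inv_cancel]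
  rw [LinearMap.comp_apply, h1, hΨ]
  rfl

/-- The intertwiner on the induced representation which extends the decoding of a function on the
quotient graph of the subgroup expresses its values by linear combinations of the restrictions of
the function to edges, with coefficients which do not depend on the function. -/
theorem exists_coeff (hΓ : Γ.IsAction G) (hs : IsInvariantOrientation G Γ.toMetricGraph s)
    {c : QuotientChoice Γ R} {hG : ∀ (h : H) (e : E), h • Γ.src e ≠ Γ.tgt e} (r : c.RowChoice hG)
    {F : (c.quotient r).Fun → IndV H.subtype R →ₗ[ℂ] Γ.Fun}
    (hF : ∀ f g w, F f (IndV.mk H.subtype R g w) = Γ.act g⁻¹ (c.decode r s f w))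
    (e : E) (w : IndV H.subtype R) :
    letI := Fintype.ofFinite c.Edge
    ∃ a : c.Edge → ℂ, (∀ p, a p ≠ 0 → (c.quotient r).len p = Γ.len e) ∧
      ∀ f, Γ.oriented s e (F f w) =
        ∑ p, a p • (c.quotient r).oriented (c.quotientOrientation s) p f := by
  let _ := Fintype.ofFinite c.Edge
  let S : Submodule ℂ (IndV H.subtype R) :=
    { carrier := {w | ∃ a : c.Edge → ℂ, (∀ p, a p ≠ 0 → (c.quotient r).len p = Γ.len e) ∧
        ∀ f, Γ.oriented s e (F f w) =
          ∑ p, a p • (c.quotient r).oriented (c.quotientOrientation s) p f}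
      zero_mem' := ⟨0, fun p h => absurd rfl h, fun f => by simp⟩
      add_mem' := by
        rintro v w ⟨a, ha, hv⟩ ⟨b, hb, hw⟩
        refine ⟨a + b, fun p h => ?_, fun f => ?_⟩
        · by_cases h' : a p = 0
          · exact hb p fun h'' => h (by rw [Pi.add_apply, h', h'', add_zero])
          · exact ha p h'
        · simp only [map_add, hv, hw, Pi.add_apply, add_smul, Finset.sum_add_distrib]
      smul_mem' := by
        rintro b w ⟨a, ha, hw⟩
        refine ⟨b • a, fun p h => ha p fun h' => h (by rw [Pi.smul_apply, h', smul_zero]),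
          fun f => ?_⟩
        simp only [map_smul, hw, Pi.smul_apply, smul_assoc, Finset.smul_sum] }
  refine indV_mem_of_mk_mem (S := S) (fun g w => ?_) w
  classical
  -- only the edges over the orbit of `g • e` contribute
  let i := orbitOf H (g • e)
  have hm : c.moveTo (g • e) • c.edgeRep i = g • e := c.moveTo_smul (g • e)
  refine ⟨fun p => ∑ j : c.Index i, if c.edge i j = p then
    (c.edgeBasis i).coord j.1 (R (c.moveTo (g • e))⁻¹ w) else 0, fun p hp => ?_, fun f => ?_⟩
  · obtain ⟨j, -, hj⟩ := Finset.exists_ne_zero_of_sum_ne_zero hp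
    obtain rfl : c.edge i j = p := by
      by_contra h
      exact hj (if_neg h)
    have h1 : (c.quotient r).len (c.edge i j) = Γ.len (c.edgeRep i) := rfl
    rw [h1, ← hΓ.len g e, ← hm]
    exact ((hΓ.restrict H).len _ _).symm
  · rw [hF, hs.oriented_act hΓ, inv_inv,
      QuotientChoice.oriented_decode (hΓ.restrict H) r f w hm]
    simp only [Finset.sum_smul, ite_smul, zero_smul]
    rw [Finset.sum_comm]
    refine Finset.sum_congr rfl fun j _ => ?_
    rw [Finset.sum_ite_eq, if_pos (Finset.mem_univ _)]

end Transplantation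

end

theorem mainTheorem4 {V E G W : Type*} [Finite V] [Finite E] [Group G] [Finite G]
    [MulAction G V] [MulAction G E]
    (Γ : QuantumGraph V E) (hΓ : Γ.IsAction G)
    (hG : ∀ (g : G) (e : E), g • Γ.src e ≠ Γ.tgt e)
    (H : Subgroup G) [AddCommGroup W] [Module ℂ W] [FiniteDimensional ℂ W]
    (R : Representation ℂ H W)
    (c₁ : QuotientChoice Γ R) (r₁ : c₁.RowChoice fun (h : H) e => hG h e)
    (c₂ : QuotientChoice Γ (Representation.ind H.subtype R)) (r₂ : c₂.RowChoice hG) :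
    ∃ T : EdgeCombination (c₁.quotient r₁).toMetricGraph (c₂.quotient r₂).toMetricGraph,
      T.IsTransplantation ∧
      ∀ (μ : ℂ) (Ψ : Representation.IndV H.subtype R →ₗ[ℂ] Γ.Fun),
        (∀ w, Ψ w ∈ Γ.eigenspace μ) →
        (∀ (g : G) w, Ψ (Representation.ind H.subtype R g w) = Γ.act g (Ψ w)) →
        T.toLinearMap (c₁.encode r₁ (Ψ ∘ₗ Representation.IndV.mk H.subtype R 1)) =
          c₂.encode r₂ Ψ := by
  obtain ⟨s, hs⟩ := exists_isInvariantOrientation hΓ hG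
  have hΓ₁ := hΓ.restrict H
  have hs₁ := hs.restrict H
  have hact : ∀ g f, actRepresentation hΓ hs g f = Γ.act g f := fun _ _ => rfl
  -- `F f` extends the decoding of `f` to an intertwiner on the induced representation
  choose F hF using fun f : (c₁.quotient r₁).Fun =>
    exists_indV_lift (actRepresentation hΓ hs) (c₁.decode r₁ s f)
      (QuotientChoice.isEquivariant_decode hΓ₁ hs₁ r₁ f)
  simp only [hact] at hF
  choose a ha hFa using exists_coeff hΓ hs r₁ hF
  have hFeq : ∀ f, IsEquivariant (Representation.ind H.subtype R) (F f) := by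
    intro f g w
    have h : F f ∘ₗ Representation.ind H.subtype R g = actRepresentation hΓ hs g ∘ₗ F f := by
      refine Representation.IndV.hom_ext _ _ fun g' => LinearMap.ext fun w => ?_
      change F f (Representation.ind H.subtype R g (Representation.IndV.mk H.subtype R g' w)) =
        actRepresentation hΓ hs g (F f (Representation.IndV.mk H.subtype R g' w))
      rw [Representation.ind_mk, hF, hF, ← hact, ← hact, mul_inv_rev, inv_inv, map_mul]
      rfl
    exact LinearMap.congr_fun h w
  have hFmk : ∀ f, F f ∘ₗ Representation.IndV.mk H.subtype R 1 = c₁.decode r₁ s f := by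
    intro f
    ext1 w
    rw [LinearMap.comp_apply, hF, inv_one, ← hact, map_one]
    rfl
  -- an intertwiner is determined by its restriction to `R`, hence by the encoding of that
  have hF_encode : ∀ Ψ, IsEquivariant (Representation.ind H.subtype R) Ψ →
      F (c₁.encode r₁ (Ψ ∘ₗ Representation.IndV.mk H.subtype R 1)) = Ψ := by
    intro Ψ hΨ
    refine Representation.IndV.hom_ext _ _ fun g => LinearMap.ext fun w => ?_
    rw [LinearMap.comp_apply, hF, QuotientChoice.decode_encode hΓ₁ hs₁ r₁
      (isEquivariant_comp_mk hΨ), LinearMap.comp_apply, ← hΨ, Representation.ind_mk, one_mul,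
      inv_inv]
    rfl
  let T : EdgeCombination (c₁.quotient r₁).toMetricGraph (c₂.quotient r₂).toMetricGraph :=
    { coeff := fun p => a (c₂.edgeRep p.1) (c₂.edgeBasis p.1 p.2.1)
      reversed := fun p q => c₁.quotientOrientation s q != c₂.quotientOrientation s p
      len_eq := fun p => ha (c₂.edgeRep p.1) (c₂.edgeBasis p.1 p.2.1) }
  have hT : ∀ f, T.toLinearMap f = c₂.encode r₂ (F f) := by
    intro f
    refine MetricGraph.ext_oriented (c₂.quotientOrientation s) fun p => ?_
    exact (T.oriented_toLinearMap (fun _ _ => rfl) f p).trans (hFa _ _ f).symm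
  have hT_encode : ∀ Ψ, IsEquivariant (Representation.ind H.subtype R) Ψ →
      T.toLinearMap (c₁.encode r₁ (Ψ ∘ₗ Representation.IndV.mk H.subtype R 1)) =
        c₂.encode r₂ Ψ := fun Ψ hΨ => by rw [hT, hF_encode Ψ hΨ]
  have hmem : ∀ μ f, T.toLinearMap f ∈ (c₂.quotient r₂).eigenspace μ ↔
      f ∈ (c₁.quotient r₁).eigenspace μ := by
    intro μ f
    rw [hT, QuotientChoice.encode_mem_eigenspace_iff hΓ hs r₂ (hFeq f)]
    conv_rhs => rw [← QuotientChoice.encode_decode hΓ₁ (s := s) r₁ f]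
    rw [QuotientChoice.encode_mem_eigenspace_iff hΓ₁ hs₁ r₁
      (QuotientChoice.isEquivariant_decode hΓ₁ hs₁ r₁ f)]
    refine ⟨fun h w => ?_, fun h => ?_⟩
    · rw [← hFmk]
      exact h _
    · refine indV_mem_of_mk_mem (S := (eigenSubmodule Γ μ).comap (F f)) fun g w => ?_
      rw [Submodule.mem_comap, hF]
      exact act_mem_eigenspace hΓ hs _ (h w)
  refine ⟨T, fun μ => ⟨fun f hf => (hmem μ f).mpr hf, fun f _ f' _ h => ?_, fun f hf => ?_⟩,
    fun μ Ψ _ hΨ => hT_encode Ψ hΨ⟩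
  · have h1 : F f = F f' := by
      rw [← QuotientChoice.decode_encode hΓ hs r₂ (hFeq f),
        ← QuotientChoice.decode_encode hΓ hs r₂ (hFeq f'), ← hT, ← hT, h]
    rw [← QuotientChoice.encode_decode hΓ₁ (s := s) r₁ f,
      ← QuotientChoice.encode_decode hΓ₁ (s := s) r₁ f', ← hFmk, ← hFmk, h1]
  · have hΨ := QuotientChoice.isEquivariant_decode hΓ hs r₂ f
    have h := hT_encode _ hΨ
    rw [QuotientChoice.encode_decode hΓ] at h
    exact ⟨_, (hmem μ _).mp (h.symm ▸ hf), h⟩
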